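/- Let $T$ be a (nondegenerate) triangle in the Euclidean plane with angles $A$, $2A$, $\pi-3A$, not all of which are rational multiples of $\pi$, and suppose that $\sin(A/2)$ is rational. A tiling of $T$ by a triangle $R$ (the tile) into $N$ tiles is a decomposition of $T$ as a union of $N$ triangles congruent to $R$ (reflections allowed) that overlap only at their boundaries. (i) There is a triangle $R$ with angles $(\alpha,\beta,\gamma)$, where $\alpha=A$ and $3\alpha+2\beta=\pi$, such that $T$ can be tiled by $R$ into finitely many tiles. (ii) For every tiling of $T$ by a triangle $R$ with angles $(\alpha,\beta,\gamma)$, where $\alpha=A$ and $3\alpha+2\beta=\pi$, the number $N$ of tiles satisfies $$N = M^2\,\frac{(2-s^2)(3-s^2)}{(1-s)^2(2+s)^2},\qquad s=2\sin(A/2),$$ for some integer $M$, and $N$ is not the square of an integer. -/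

import Mathlib

/-- The Euclidean plane. -/
abbrev Plane : Type := EuclideanSpace ℝ (Fin 2)

/-- A nondegenerate triangle in the plane, given by its three (affinely independent) vertices. -/
abbrev PlaneTriangle : Type := Affine.Triangle ℝ Plane

namespace PlaneTriangle

/-- The (unoriented) angle of `T` at its `i`-th vertex; the indices `i + 1`, `i + 2` are modulo 3. -/
noncomputable def angleAt (T : PlaneTriangle) (i : Fin 3) : ℝ :=
  EuclideanGeometry.angle (T.points (i + 1)) (T.points i) (T.points (i + 2))

/-- The angles of `T` are `x`, `y`, `z` in some order. -/
def HasAngles (T : PlaneTriangle) (x y z : ℝ) : Prop :=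
  ∃ σ : Equiv.Perm (Fin 3), T.angleAt (σ 0) = x ∧ T.angleAt (σ 1) = y ∧ T.angleAt (σ 2) = z

/-- All angles of `T` are rational multiples of `π`. -/
def CommensurableAngles (T : PlaneTriangle) : Prop :=
  ∀ i : Fin 3, ∃ q : ℚ, T.angleAt i = q * Real.pi

/-- Two triangles are congruent: some matching of the vertices preserves distances
(reflections are allowed). -/
def IsCongruentTo (S R : PlaneTriangle) : Prop :=
  ∃ σ : Equiv.Perm (Fin 3), Congruent (S.points ∘ σ) R.points

/-- The `N` triangles `t 0, …, t (N - 1)` form a tiling of `T` with tile `R`: each is congruent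
to `R`, their union is the full closed triangle `T`, and any two of them overlap only at their
boundaries. -/
structure IsTiling (T R : PlaneTriangle) (N : ℕ) (t : Fin N → PlaneTriangle) : Prop where
  congr : ∀ i, (t i).IsCongruentTo R
  cover : ⋃ i, (t i).closedInterior = T.closedInterior
  disjoint : ∀ i j, i ≠ j → Disjoint (t i).interior (t j).interior

/-- `T` can be tiled by `N` triangles congruent to `R`. -/
def TilesInto (T R : PlaneTriangle) (N : ℕ) : Prop :=
  ∃ t : Fin N → PlaneTriangle, T.IsTiling R N t

end PlaneTriangle

/-! Put `s = 2 sin(A/2)` and `b = 1 - s²`. By the law of sines the tile has sides proportional to `s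
: b : 1`, and `T` has sides `l`, `l(1 + b)`, `l·b(2 + b)`. Since `s` is rational, all ratios of
lengths within each triangle are rational.

Counting. With `κ = l/r`, comparing areas by Heron's formula gives `N = κ²(2 - s²)(3 - s²)`. Every
side of `T` is covered by whole sides of tiles (`IsTiling.dist_eq_sum`), so `κ` and `κ(1 - s²)(3 -
s²)` are both natural combinations of `s`, `1 - s²` and `1`. Writing `s = p/q` in lowest terms and
clearing denominators, coprimality forces `κ = q²j` with `j` an integer. Hence `N = j²(2q² - p²)(3q²
- p²)`, which has the asserted form. The last two factors are coprime, so if `N` were a square then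
`3q² - p²` would be one too, which descent modulo 3 forbids (`tile_count_arithmetic`).

Existence. It suffices to cut `T` into triangles similar to the tile with rational ratios, because
quadratic tilings then refine all of them to one common tile (`Dissects.exists_common_tile`). Two
such triangles cut off from `T` leave an isosceles triangle with apex `α`. Two more leave an
isosceles trapezoid with base angles `α`. The trapezoid is sliced into thin strips, each a
parallelogram with angle `α` capped by a small isosceles trapezoid made of three similar tiles.
Everything is verified in an oblique frame where the vertices have coordinates rational in `b`
(`TileFrame.dissects_main`). -/

open MeasureTheory

namespace PlaneTriangle

/-! ### Barycentric coordinates, congruence and area. -/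

/-- The vertices of a triangle as an affine basis of the plane. -/
noncomputable def basis (T : PlaneTriangle) : AffineBasis (Fin 3) ℝ Plane where
  toFun := T.points
  ind' := T.independent
  tot' := by
    rw [T.independent.affineSpan_eq_top_iff_card_eq_finrank_add_one]
    simp

@[simp] lemma coe_basis (T : PlaneTriangle) : ⇑T.basis = T.points := rfl

lemma mem_closedInterior_iff_coord (T : PlaneTriangle) (x : Plane) :
    x ∈ T.closedInterior ↔ ∀ i, 0 ≤ T.basis.coord i x := by
  rw [← Affine.Simplex.convexHull_eq_closedInterior, ← coe_basis,
    AffineBasis.convexHull_eq_nonneg_coord]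
  rfl

lemma mem_interior_iff_coord (T : PlaneTriangle) (x : Plane) :
    x ∈ T.interior ↔ ∀ i, 0 < T.basis.coord i x := by
  have hs := T.basis.sum_coord_apply_eq_one x
  have hx := T.basis.affineCombination_coord_eq_self x
  conv_lhs => rw [← hx]
  rw [coe_basis, Affine.Simplex.affineCombination_mem_interior_iff hs]
  refine ⟨fun h i => (h i).1, fun h i => ⟨h i, ?_⟩⟩
  rw [Fin.sum_univ_three] at hs
  have h0 := h 0
  have h1 := h 1
  have h2 := h 2
  fin_cases i <;> simp only [Fin.zero_eta, Fin.mk_one, Fin.reduceFinMk] <;> linarith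

lemma interior_eq (T : PlaneTriangle) : T.interior = interior T.closedInterior := by
  ext x
  rw [mem_interior_iff_coord, ← Affine.Simplex.convexHull_eq_closedInterior, ← coe_basis,
    AffineBasis.interior_convexHull]
  rfl

lemma mem_closedInterior_iff_exists (T : PlaneTriangle) (x : Plane) :
    x ∈ T.closedInterior ↔ ∃ a b : ℝ, 0 ≤ a ∧ 0 ≤ b ∧ a + b ≤ 1 ∧
      x = T.points 0 + a • (T.points 1 - T.points 0) + b • (T.points 2 - T.points 0) := by
  rw [← Affine.Simplex.convexHull_eq_closedInterior]
  have hr : Set.range T.points = {T.points 0, T.points 1, T.points 2} := by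
    ext y
    simp [Fin.exists_fin_succ, eq_comm]
  rw [hr, convexHull_insert (by simp), convexHull_pair]
  simp only [convexJoin_singleton_left, Set.mem_iUnion, exists_prop]
  constructor
  · rintro ⟨y, ⟨a, b, ha, hb, hab, rfl⟩, c, d, hc, hd, hcd, rfl⟩
    refine ⟨d * a, d * b, by positivity, by positivity, ?_, ?_⟩
    · rw [← mul_add, hab]; linarith
    · obtain rfl : c = 1 - d := by linarith
      obtain rfl : a = 1 - b := by linarith
      module
  · rintro ⟨a, b, ha, hb, hab, rfl⟩
    rcases eq_or_lt_of_le (add_nonneg ha hb) with h | h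
    · obtain rfl : a = 0 := by linarith
      obtain rfl : b = 0 := by linarith
      exact ⟨T.points 1, left_mem_segment _ _ _, by simpa using left_mem_segment ℝ _ _⟩
    · refine ⟨(a / (a + b)) • T.points 1 + (b / (a + b)) • T.points 2,
        ⟨_, _, by positivity, by positivity, by field_simp, rfl⟩,
        1 - (a + b), a + b, by linarith, h.le, by ring, ?_⟩
      rw [smul_add, smul_smul, smul_smul, mul_div_cancel₀ _ h.ne', mul_div_cancel₀ _ h.ne']
      module

/-- Side lengths of `T` (in the order opposite to `σ 0`, `σ 1`, `σ 2` for some `σ`). -/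
def HasSides (T : PlaneTriangle) (x y z : ℝ) : Prop :=
  ∃ σ : Equiv.Perm (Fin 3), dist (T.points (σ 1)) (T.points (σ 2)) = x ∧
    dist (T.points (σ 2)) (T.points (σ 0)) = y ∧ dist (T.points (σ 0)) (T.points (σ 1)) = z

lemma isCongruentTo_of_dist_eq {S R : PlaneTriangle} (σ : Equiv.Perm (Fin 3))
    (h0 : dist (S.points (σ 1)) (S.points (σ 2)) = dist (R.points 1) (R.points 2))
    (h1 : dist (S.points (σ 2)) (S.points (σ 0)) = dist (R.points 2) (R.points 0))
    (h2 : dist (S.points (σ 0)) (S.points (σ 1)) = dist (R.points 0) (R.points 1)) :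
    S.IsCongruentTo R := by
  refine ⟨σ, fun i j => ?_⟩
  simp only [edist_dist, Function.comp]
  congr 1
  fin_cases i <;> fin_cases j <;>
    simp only [Fin.zero_eta, Fin.mk_one, Fin.reduceFinMk, dist_self] <;>
    first
      | assumption
      | (rw [dist_comm, dist_comm (R.points _)]; assumption)

lemma IsCongruentTo.dist_eq {S R : PlaneTriangle} (h : S.IsCongruentTo R) :
    ∃ σ : Equiv.Perm (Fin 3), ∀ i j,
      dist (S.points (σ i)) (S.points (σ j)) = dist (R.points i) (R.points j) := by
  obtain ⟨σ, h⟩ := h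
  refine ⟨σ, fun i j => ?_⟩
  have := h i j
  simpa [edist_dist, ENNReal.ofReal_eq_ofReal_iff dist_nonneg dist_nonneg] using this

/-- Twice the signed area. -/
noncomputable def det (T : PlaneTriangle) : ℝ :=
  (T.points 1 0 - T.points 0 0) * (T.points 2 1 - T.points 0 1) -
    (T.points 1 1 - T.points 0 1) * (T.points 2 0 - T.points 0 0)

/-- Heron's formula: both sides are 16 times the squared area. It makes the area depend on the side
lengths only, hence invariant under congruence. -/
lemma four_mul_det_sq (T : PlaneTriangle) (x y z : ℝ)
    (h : T.HasSides x y z) :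
    4 * T.det ^ 2 = 2 * x ^ 2 * y ^ 2 + 2 * y ^ 2 * z ^ 2 + 2 * z ^ 2 * x ^ 2
      - x ^ 4 - y ^ 4 - z ^ 4 := by
  have key : ∀ P Q : Plane, dist P Q ^ 2 = (P 0 - Q 0) ^ 2 + (P 1 - Q 1) ^ 2 := by
    intro P Q
    rw [EuclideanSpace.dist_eq, Real.sq_sqrt (by positivity), Fin.sum_univ_two,
      Real.dist_eq, Real.dist_eq, sq_abs, sq_abs]
  obtain ⟨σ, rfl, rfl, rfl⟩ := h
  have e4 : ∀ t : ℝ, t ^ 4 = (t ^ 2) ^ 2 := fun t => by ring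
  simp only [e4, key, det]
  have hσ : ∀ i j k : Fin 3, i ≠ j → j ≠ k → i ≠ k →
    4 * ((T.points 1 0 - T.points 0 0) * (T.points 2 1 - T.points 0 1) -
    (T.points 1 1 - T.points 0 1) * (T.points 2 0 - T.points 0 0)) ^ 2 =
    4 * ((T.points j 0 - T.points i 0) * (T.points k 1 - T.points i 1) -
    (T.points j 1 - T.points i 1) * (T.points k 0 - T.points i 0)) ^ 2 := by
    intro i j k hij hjk hik
    fin_cases i <;> fin_cases j <;> fin_cases k <;> simp at hij hjk hik <;>
      simp only [Fin.zero_eta, Fin.mk_one, Fin.reduceFinMk] <;> ring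
  rw [hσ (σ 0) (σ 1) (σ 2) (by simp) (by simp) (by simp)]
  ring

/-- The standard triangle with vertices `(0,0)`, `(1,0)`, `(0,1)`. -/
def unitTriangle : Set Plane := {v | 0 ≤ v 0 ∧ 0 ≤ v 1 ∧ v 0 + v 1 ≤ 1}

lemma volume_closedInterior (T : PlaneTriangle) :
    volume T.closedInterior = ENNReal.ofReal |T.det| * volume unitTriangle := by
  let b := (EuclideanSpace.basisFun (Fin 2) ℝ).toBasis
  let M : Matrix (Fin 2) (Fin 2) ℝ :=
    !![T.points 1 0 - T.points 0 0, T.points 2 0 - T.points 0 0;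
       T.points 1 1 - T.points 0 1, T.points 2 1 - T.points 0 1]
  let L : Plane →ₗ[ℝ] Plane := Matrix.toLin b b M
  have hL : ∀ v : Plane,
      L v = v 0 • (T.points 1 - T.points 0) + v 1 • (T.points 2 - T.points 0) := by
    intro v
    ext i
    simp only [L, Matrix.toLin_apply, b]
    fin_cases i <;> simp [M, Matrix.mulVec, dotProduct, Fin.sum_univ_two] <;> ring
  have hdet : LinearMap.det L = T.det := by
    simp only [L, LinearMap.det_toLin, M, Matrix.det_fin_two_of, det]
    ring
  have him : T.closedInterior = (fun v => T.points 0 + v) '' (L '' unitTriangle) := by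
    ext x
    rw [mem_closedInterior_iff_exists]
    simp only [Set.mem_image, exists_exists_and_eq_and, hL]
    constructor
    · rintro ⟨a, c, ha, hc, hac, rfl⟩
      exact ⟨!₂[a, c], ⟨by simpa using ha, by simpa using hc, by simpa using hac⟩,
        by simp [add_assoc]⟩
    · rintro ⟨v, ⟨h0, h1, h2⟩, rfl⟩
      exact ⟨v 0, v 1, h0, h1, h2, by simp [add_assoc]⟩
  rw [him, Set.image_add_left, measure_preimage_add, Measure.addHaar_image_linearMap, hdet]

lemma volume_closedInterior_ne_zero (T : PlaneTriangle) : volume T.closedInterior ≠ 0 := by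
  have h : (interior T.closedInterior).Nonempty := by
    refine ⟨Finset.univ.centroid ℝ T.basis, ?_⟩
    rw [← Affine.Simplex.convexHull_eq_closedInterior]
    exact AffineBasis.centroid_mem_interior_convexHull T.basis
  exact (Measure.measure_pos_of_nonempty_interior _ h).ne'

lemma volume_closedInterior_ne_top (T : PlaneTriangle) : volume T.closedInterior ≠ ⊤ :=
  T.isCompact_closedInterior.measure_ne_top

/-- The frontier of a convex set is null, so closed triangles may replace open ones when areas are
added. -/
lemma aedisjoint_closedInterior {S T : PlaneTriangle} (h : Disjoint S.interior T.interior) :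
    AEDisjoint volume S.closedInterior T.closedInterior := by
  have key : ∀ U : PlaneTriangle, U.interior =ᵐ[volume] U.closedInterior := by
    intro U
    rw [interior_eq]
    refine interior_ae_eq_of_null_frontier ?_
    rw [← Affine.Simplex.convexHull_eq_closedInterior]
    exact (convex_convexHull ℝ _).addHaar_frontier volume
  exact AEDisjoint.congr h.aedisjoint (key S).symm (key T).symm

lemma IsCongruentTo.hasSides {S R : PlaneTriangle} (h : S.IsCongruentTo R) {x y z : ℝ}
    (hR : R.HasSides x y z) : S.HasSides x y z := by
  obtain ⟨σ, hσ⟩ := h.dist_eq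
  obtain ⟨τ, h0, h1, h2⟩ := hR
  exact ⟨τ.trans σ, by simp [hσ, h0], by simp [hσ, h1], by simp [hσ, h2]⟩

lemma exists_hasSides (T : PlaneTriangle) : ∃ x y z, T.HasSides x y z :=
  ⟨_, _, _, Equiv.refl _, rfl, rfl, rfl⟩

lemma IsCongruentTo.abs_det_eq {S R : PlaneTriangle} (h : S.IsCongruentTo R) :
    |S.det| = |R.det| := by
  obtain ⟨x, y, z, hR⟩ := R.exists_hasSides
  have h1 := four_mul_det_sq _ _ _ _ hR
  have h2 := four_mul_det_sq _ _ _ _ (h.hasSides hR)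
  rw [← sq_eq_sq_iff_abs_eq_abs]
  linarith

/-- The number of tiles is the quotient of the areas. -/
lemma IsTiling.card_mul_abs_det {T R : PlaneTriangle} {N : ℕ} {t : Fin N → PlaneTriangle}
    (h : T.IsTiling R N t) : N * |R.det| = |T.det| := by
  have hv : volume T.closedInterior = ∑ i, volume (t i).closedInterior := by
    rw [← h.cover, measure_iUnion₀, tsum_fintype]
    · exact fun i j hij => aedisjoint_closedInterior (h.disjoint i j hij)
    · exact fun i => (t i).isClosed_closedInterior.nullMeasurableSet
  have h0 := T.volume_closedInterior_ne_zero
  have h1 := T.volume_closedInterior_ne_top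
  simp only [volume_closedInterior, (h.congr _).abs_det_eq, Finset.sum_const, Finset.card_univ,
    Fintype.card_fin, nsmul_eq_mul, ← mul_assoc] at hv h0 h1
  have hT : 0 < |T.det| := by
    refine (abs_nonneg _).lt_of_ne fun h => h0 ?_
    simp [← h]
  -- The area of the standard triangle is never computed: it is a common factor that cancels once
  -- known to be nonzero and finite.
  have h2 : volume unitTriangle ≠ 0 := fun h => h0 (by simp [h])
  have h3 : volume unitTriangle ≠ ⊤ := fun h => h1 (by
    rw [h]; exact ENNReal.mul_top (by simpa using hT))
  rw [ENNReal.mul_left_inj h2 h3, ← ENNReal.ofReal_natCast, ← ENNReal.ofReal_mul (by positivity),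
    ENNReal.ofReal_eq_ofReal_iff (by positivity) (by positivity)] at hv
  exact hv.symm

/-! ### Sides of a tiled triangle -/

lemma coord_point_self (T : PlaneTriangle) (i : Fin 3) : T.basis.coord i (T.points i) = 1 :=
  T.basis.coord_apply_eq i

lemma coord_point_ne (T : PlaneTriangle) {i j : Fin 3} (h : i ≠ j) :
    T.basis.coord i (T.points j) = 0 :=
  T.basis.coord_apply_ne h

/-- An affine function is determined by its values at the vertices. -/
lemma affineMap_apply (T : PlaneTriangle) (f : Plane →ᵃ[ℝ] ℝ) (x : Plane) :
    f x = ∑ i, T.basis.coord i x * f (T.points i) := by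
  conv_lhs => rw [← T.basis.affineCombination_coord_eq_self x]
  rw [Finset.map_affineCombination _ _ _ (T.basis.sum_coord_apply_eq_one x),
    Finset.affineCombination_eq_linear_combination _ _ _ (T.basis.sum_coord_apply_eq_one x)]
  rfl

lemma eq_sum_coord (T : PlaneTriangle) (x : Plane) :
    x = ∑ i, T.basis.coord i x • T.points i := by
  conv_lhs => rw [← T.basis.affineCombination_coord_eq_self x]
  rw [Finset.affineCombination_eq_linear_combination _ _ _ (T.basis.sum_coord_apply_eq_one x)]
  rfl

/-- A vanishing sum of nonnegative terms vanishes term by term: a point of `S` on a supporting line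
only involves the vertices on that line. -/
lemma coord_eq_zero_or_of_apply_eq_zero (S : PlaneTriangle) {f : Plane →ᵃ[ℝ] ℝ}
    (hf : ∀ i, 0 ≤ f (S.points i)) {x : Plane} (hx : x ∈ S.closedInterior) (hfx : f x = 0)
    (i : Fin 3) : S.basis.coord i x = 0 ∨ f (S.points i) = 0 := by
  rw [mem_closedInterior_iff_coord] at hx
  rw [affineMap_apply S, Finset.sum_eq_zero_iff_of_nonneg
    fun i _ => mul_nonneg (hx i) (hf i)] at hfx
  exact mul_eq_zero.1 (hfx i (Finset.mem_univ i))

/-- A supporting line through two vertices meets the triangle in a side. -/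
lemma closedInterior_inter_eq_segment (S : PlaneTriangle) {f : Plane →ᵃ[ℝ] ℝ} {i j k : Fin 3}
    (hij : i ≠ j) (hjk : j ≠ k) (hik : i ≠ k) (hi : f (S.points i) = 0)
    (hj : f (S.points j) = 0) (hk : 0 < f (S.points k)) :
    S.closedInterior ∩ {x | f x = 0} = segment ℝ (S.points i) (S.points j) := by
  have huniv : (Finset.univ : Finset (Fin 3)) = {i, j, k} :=
    (by decide : ∀ i j k : Fin 3, i ≠ j → j ≠ k → i ≠ k →
      (Finset.univ : Finset (Fin 3)) = {i, j, k}) i j k hij hjk hik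
  have hsum : ∀ {M : Type} [AddCommMonoid M] (g : Fin 3 → M), ∑ l, g l = g i + g j + g k := by
    intro M _ g
    rw [huniv, Finset.sum_insert (by simp [hij, hik]), Finset.sum_insert (by simp [hjk]),
      Finset.sum_singleton, add_assoc]
  have hnn : ∀ l, 0 ≤ f (S.points l) := by
    intro l
    have : l ∈ ({i, j, k} : Finset (Fin 3)) := huniv ▸ Finset.mem_univ l
    simp only [Finset.mem_insert, Finset.mem_singleton] at this
    rcases this with rfl | rfl | rfl
    exacts [hi.ge, hj.ge, hk.le]
  ext x
  constructor
  · rintro ⟨hx, hfx⟩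
    have h0 := (S.coord_eq_zero_or_of_apply_eq_zero hnn hx hfx k).resolve_right hk.ne'
    rw [mem_closedInterior_iff_coord] at hx
    have h1 := S.basis.sum_coord_apply_eq_one x
    have h2 := S.eq_sum_coord x
    rw [hsum] at h1 h2
    rw [h0] at h1 h2
    exact ⟨_, _, hx i, hx j, by linarith, by rw [zero_smul, add_zero] at h2; exact h2.symm⟩
  · rintro hx
    refine ⟨?_, ?_⟩
    · rw [← Affine.Simplex.convexHull_eq_closedInterior]
      exact (convex_convexHull ℝ _).segment_subset (subset_convexHull ℝ _ (Set.mem_range_self i))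
        (subset_convexHull ℝ _ (Set.mem_range_self j)) hx
    · obtain ⟨a, b, -, -, hab, rfl⟩ := hx
      rw [Set.mem_ofPred_eq, Convex.combo_affine_apply hab, hi, hj]
      simp

lemma eq_point_of_coord (S : PlaneTriangle) {x : Plane} {i : Fin 3}
    (h : ∀ j, j ≠ i → S.basis.coord j x = 0) : x = S.points i := by
  have h1 := S.basis.sum_coord_apply_eq_one x
  rw [Finset.sum_eq_single i (fun j _ hj => h j hj) (by simp)] at h1
  have h2 := S.eq_sum_coord x
  rwa [Finset.sum_eq_single i (fun j _ hj => by rw [h j hj, zero_smul]) (by simp), h1,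
    one_smul] at h2

open Measure in
/-- A supporting line meets a triangle in a set of length `0` or in a side. -/
lemma hausdorffMeasure_closedInterior_inter (S : PlaneTriangle) {f : Plane →ᵃ[ℝ] ℝ}
    (hf : ∀ i, 0 ≤ f (S.points i)) (hf0 : ∃ x, f x ≠ 0) :
    μH[1] (S.closedInterior ∩ {x | f x = 0}) = 0 ∨
      ∃ i j, i ≠ j ∧ μH[1] (S.closedInterior ∩ {x | f x = 0}) =
        ENNReal.ofReal (dist (S.points i) (S.points j)) := by
  by_cases h : ∃ i j, i ≠ j ∧ f (S.points i) = 0 ∧ f (S.points j) = 0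
  · right
    obtain ⟨i, j, hij, hi, hj⟩ := h
    obtain ⟨k, hk⟩ : ∃ k, f (S.points k) ≠ 0 := by
      by_contra! h
      obtain ⟨x, hx⟩ := hf0
      exact hx (by rw [affineMap_apply S]; simp [h])
    refine ⟨i, j, hij, ?_⟩
    rw [S.closedInterior_inter_eq_segment hij (by rintro rfl; exact hk hj)
      (by rintro rfl; exact hk hi) hi hj ((hf k).lt_of_ne' hk), hausdorffMeasure_segment,
      edist_dist]
  · left
    push Not at h
    have := nullSingletonClass_hausdorff Plane one_pos
    refine measure_mono_null (t := Set.range S.points) ?_ ((Set.finite_range _).measure_zero _)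
    rintro x ⟨hx, hfx⟩
    have h0 := S.coord_eq_zero_or_of_apply_eq_zero hf hx hfx
    by_cases h1 : ∃ i, f (S.points i) = 0
    · obtain ⟨i, hi⟩ := h1
      exact ⟨i, (S.eq_point_of_coord fun j hj => (h0 j).resolve_right (h i j hj.symm hi)).symm⟩
    · push Not at h1
      exact ⟨0, (S.eq_point_of_coord fun j _ => (h0 j).resolve_right (h1 j)).symm⟩

-- If one coordinate of `x` vanishes and `x` is not a vertex, then both other vertices lie on `f =
-- 0`, so `f` is a positive multiple of that coordinate and moving towards `q` increases it.
-- Positive coordinates stay positive by continuity. As `q` need not lie in `S`, one `q` serves two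
-- tiles at once.
open Filter Topology in
lemma eventually_lineMap_mem_interior (S : PlaneTriangle) {f : Plane →ᵃ[ℝ] ℝ}
    (hf : ∀ i, 0 ≤ f (S.points i)) {x q : Plane} (hx : x ∈ S.closedInterior) (hfx : f x = 0)
    (hq : 0 < f q) (hxS : x ∉ Set.range S.points) :
    ∀ᶠ ε in 𝓝[>] (0 : ℝ), AffineMap.lineMap x q ε ∈ S.interior := by
  have h0 := S.coord_eq_zero_or_of_apply_eq_zero hf hx hfx
  rw [mem_closedInterior_iff_coord] at hx
  simp only [mem_interior_iff_coord]
  rw [eventually_all]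
  intro i
  have hcont : Tendsto (fun ε : ℝ => S.basis.coord i (AffineMap.lineMap x q ε)) (𝓝 0)
      (𝓝 (S.basis.coord i x)) := by
    have : Continuous fun ε : ℝ => S.basis.coord i (AffineMap.lineMap x q ε) :=
      (continuous_barycentric_coord S.basis i).comp AffineMap.lineMap_continuous
    simpa using this.tendsto 0
  rcases (hx i).eq_or_lt with h1 | h1
  · have hz : ∀ j, j ≠ i → f (S.points j) = 0 := by
      intro j hj
      refine (h0 j).resolve_left fun h2 => hxS ?_
      obtain ⟨k, hki, hkj, hk⟩ : ∃ k : Fin 3, k ≠ i ∧ k ≠ j ∧ ∀ l, l ≠ k → l = i ∨ l = j :=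
        (by decide : ∀ i j : Fin 3, j ≠ i →
          ∃ k : Fin 3, k ≠ i ∧ k ≠ j ∧ ∀ l, l ≠ k → l = i ∨ l = j) i j hj
      refine ⟨k, (S.eq_point_of_coord fun l hl => ?_).symm⟩
      rcases hk l hl with rfl | rfl
      exacts [h1.symm, h2]
    have hfi : ∀ y, f y = S.basis.coord i y * f (S.points i) := by
      intro y
      rw [affineMap_apply S, Finset.sum_eq_single i (fun j _ hj => by rw [hz j hj, mul_zero])
        (by simp)]
    have hfpos : 0 < f (S.points i) := by
      refine (hf i).lt_of_ne fun h => ?_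
      rw [hfi, ← h, mul_zero] at hq
      exact hq.false
    filter_upwards [self_mem_nhdsWithin] with ε hε
    have h3 : f (AffineMap.lineMap x q ε) = ε * f q := by
      rw [AffineMap.apply_lineMap, hfx, AffineMap.lineMap_apply_module]
      simp
    rw [hfi] at h3
    have : 0 < S.basis.coord i (AffineMap.lineMap x q ε) * f (S.points i) := by
      rw [h3]; exact mul_pos hε hq
    exact pos_of_mul_pos_left this hfpos.le
  · exact (hcont.eventually (lt_mem_nhds h1)).filter_mono nhdsWithin_le_nhds

-- A common point on the line that is a vertex of neither triangle could be pushed off the line into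
-- both interiors. Only the finitely many vertices remain, and these have no length.
open Measure in
lemma aedisjoint_hausdorffMeasure {S S' : PlaneTriangle} (hd : Disjoint S.interior S'.interior)
    {f : Plane →ᵃ[ℝ] ℝ} (hf : ∀ i, 0 ≤ f (S.points i)) (hf' : ∀ i, 0 ≤ f (S'.points i))
    (hf0 : ∃ x, 0 < f x) :
    AEDisjoint μH[1] (S.closedInterior ∩ {x | f x = 0}) (S'.closedInterior ∩ {x | f x = 0}) := by
  have := nullSingletonClass_hausdorff Plane one_pos
  refine measure_mono_null (t := Set.range S.points ∪ Set.range S'.points) ?_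
    (((Set.finite_range _).union (Set.finite_range _)).measure_zero _)
  rintro x ⟨⟨hx, hfx⟩, hx', -⟩
  by_contra hn
  rw [Set.mem_union, not_or] at hn
  obtain ⟨q, hq⟩ := hf0
  obtain ⟨ε, h1, h2⟩ := ((S.eventually_lineMap_mem_interior hf hx hfx hq hn.1).and
    (S'.eventually_lineMap_mem_interior hf' hx' hfx hq hn.2)).exists
  exact Set.disjoint_left.1 hd h1 h2

lemma HasSides.dist_mem {S : PlaneTriangle} {x y z : ℝ} (h : S.HasSides x y z) {i j : Fin 3}
    (hij : i ≠ j) : dist (S.points i) (S.points j) = x ∨ dist (S.points i) (S.points j) = y ∨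
      dist (S.points i) (S.points j) = z := by
  obtain ⟨σ, rfl, rfl, rfl⟩ := h
  obtain ⟨i, rfl⟩ := σ.surjective i
  obtain ⟨j, rfl⟩ := σ.surjective j
  fin_cases i <;> fin_cases j <;> simp at hij <;>
    simp only [Fin.zero_eta, Fin.mk_one, Fin.reduceFinMk, true_or, or_true] <;>
    rw [dist_comm] <;> simp only [true_or, or_true]

open Measure in
/-- Each side of a tiled triangle is a sum of sides of tiles. -/
lemma IsTiling.dist_eq_sum {T R : PlaneTriangle} {N : ℕ} {t : Fin N → PlaneTriangle}
    (h : T.IsTiling R N t) {x y z : ℝ} (hR : R.HasSides x y z) {i j : Fin 3} (hij : i ≠ j) :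
    ∃ l m n : ℕ, dist (T.points i) (T.points j) = l * x + m * y + n * z := by
  obtain ⟨k, hik, hjk⟩ : ∃ k : Fin 3, i ≠ k ∧ j ≠ k :=
    (by decide : ∀ i j : Fin 3, i ≠ j → ∃ k : Fin 3, i ≠ k ∧ j ≠ k) i j hij
  -- The coordinate of the opposite vertex is nonnegative on all of `T` and cuts out the side, so
  -- its zero line supports every tile.
  let f : Plane →ᵃ[ℝ] ℝ := T.basis.coord k
  have hi : f (T.points i) = 0 := T.coord_point_ne hik.symm
  have hj : f (T.points j) = 0 := T.coord_point_ne hjk.symm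
  have hk : f (T.points k) = 1 := T.coord_point_self k
  have hseg := T.closedInterior_inter_eq_segment hij hjk hik hi hj (by rw [hk]; exact one_pos)
  have hpos : ∀ a i, 0 ≤ f ((t a).points i) := by
    intro a i
    have : (t a).points i ∈ T.closedInterior := by
      rw [← h.cover]
      exact Set.mem_iUnion_of_mem a ((t a).point_mem_closedInterior i)
    rw [mem_closedInterior_iff_coord] at this
    exact this k
  have hlen : ENNReal.ofReal (dist (T.points i) (T.points j)) =
      ∑ a, μH[1] ((t a).closedInterior ∩ {x | f x = 0}) := by
    rw [← edist_dist, ← hausdorffMeasure_segment, ← hseg, ← h.cover, Set.iUnion_inter,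
      measure_iUnion₀, tsum_fintype]
    · intro a b hab
      exact aedisjoint_hausdorffMeasure (h.disjoint a b hab) (hpos a) (hpos b)
        ⟨T.points k, by rw [hk]; exact one_pos⟩
    · intro a
      refine MeasurableSet.nullMeasurableSet (IsClosed.measurableSet ?_)
      exact (t a).isClosed_closedInterior.inter
        (isClosed_eq (continuous_barycentric_coord T.basis k) continuous_const)
  have hx : 0 ≤ x := by obtain ⟨σ, rfl, rfl, rfl⟩ := hR; exact dist_nonneg
  have hy : 0 ≤ y := by obtain ⟨σ, rfl, rfl, rfl⟩ := hR; exact dist_nonneg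
  have hz : 0 ≤ z := by obtain ⟨σ, rfl, rfl, rfl⟩ := hR; exact dist_nonneg
  have hpiece : ∀ a, ∃ l m n : ℕ, μH[1] ((t a).closedInterior ∩ {x | f x = 0}) =
      ENNReal.ofReal (l * x + m * y + n * z) := by
    intro a
    rcases (t a).hausdorffMeasure_closedInterior_inter (hpos a)
      ⟨T.points k, by rw [hk]; exact one_ne_zero⟩ with h0 | ⟨i, j, hij, h0⟩
    · exact ⟨0, 0, 0, by simp [h0]⟩
    · rw [h0]
      rcases ((h.congr a).hasSides hR).dist_mem hij with h1 | h1 | h1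
      · exact ⟨1, 0, 0, by simp [h1]⟩
      · exact ⟨0, 1, 0, by simp [h1]⟩
      · exact ⟨0, 0, 1, by simp [h1]⟩
  choose l m n hlmn using hpiece
  refine ⟨∑ a, l a, ∑ a, m a, ∑ a, n a, ?_⟩
  simp only [hlmn] at hlen
  rw [← ENNReal.ofReal_sum_of_nonneg (fun a _ => by positivity),
    ENNReal.ofReal_eq_ofReal_iff dist_nonneg (Finset.sum_nonneg fun a _ => by positivity)] at hlen
  rw [hlen]
  push_cast
  simp only [Finset.sum_add_distrib, Finset.sum_mul]

/-! ### From angles to side ratios. -/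

lemma not_collinear (T : PlaneTriangle) {i j k : Fin 3} (hij : i ≠ j) (hjk : j ≠ k)
    (hik : i ≠ k) : ¬ Collinear ℝ {T.points i, T.points j, T.points k} := by
  have h : ({T.points i, T.points j, T.points k} : Set Plane) = Set.range T.points := by
    have : (Set.univ : Set (Fin 3)) = {i, j, k} := by
      ext l
      simpa using (by decide : ∀ i j k l : Fin 3, i ≠ j → j ≠ k → i ≠ k → l = i ∨ l = j ∨ l = k)
        i j k l hij hjk hik
    rw [← Set.image_univ, this]
    simp [Set.image_insert_eq]
  rw [h, ← affineIndependent_iff_not_collinear]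
  exact T.independent

lemma angleAt_eq (T : PlaneTriangle) {i j k : Fin 3} (hij : i ≠ j) (hjk : j ≠ k) (hik : i ≠ k) :
    T.angleAt i = EuclideanGeometry.angle (T.points j) (T.points i) (T.points k) := by
  rcases (by decide : ∀ i j k : Fin 3, i ≠ j → j ≠ k → i ≠ k →
    (j = i + 1 ∧ k = i + 2) ∨ (j = i + 2 ∧ k = i + 1)) i j k hij hjk hik with
    ⟨rfl, rfl⟩ | ⟨rfl, rfl⟩
  · rfl
  · exact EuclideanGeometry.angle_comm _ _ _

/-- The law of sines. -/
lemma HasAngles.hasSides {T : PlaneTriangle} {x y z : ℝ} (h : T.HasAngles x y z) :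
    0 < x ∧ 0 < y ∧ 0 < z ∧ x + y + z = Real.pi ∧
      ∃ d, 0 < d ∧ T.HasSides (d * Real.sin x) (d * Real.sin y) (d * Real.sin z) := by
  obtain ⟨σ, hx, hy, hz⟩ := h
  have h01 : σ 0 ≠ σ 1 := by simp
  have h12 : σ 1 ≠ σ 2 := by simp
  have h02 : σ 0 ≠ σ 2 := by simp
  rw [T.angleAt_eq h01 h12 h02] at hx
  rw [T.angleAt_eq h12 h02.symm h01.symm] at hy
  rw [T.angleAt_eq h02.symm h01 h12.symm] at hz
  have sx := EuclideanGeometry.sin_pos_of_not_collinear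
    (T.not_collinear h01.symm h02 h12)
  have sy := EuclideanGeometry.sin_pos_of_not_collinear
    (T.not_collinear h12.symm h01.symm h02.symm)
  have sz := EuclideanGeometry.sin_pos_of_not_collinear
    (T.not_collinear h02 h12.symm h01)
  have l1 := EuclideanGeometry.law_sin (T.points (σ 1)) (T.points (σ 0)) (T.points (σ 2))
  have l2 := EuclideanGeometry.law_sin (T.points (σ 2)) (T.points (σ 1)) (T.points (σ 0))
  have hsum := EuclideanGeometry.angle_add_angle_add_angle_eq_pi (T.points (σ 2))
    (T.independent.injective.ne h01)
  rw [hx, hy, hz] at hsum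
  rw [hx, hy] at l1
  rw [hy, hz] at l2
  rw [hx] at sx
  rw [hy] at sy
  rw [hz] at sz
  have pos : ∀ P Q R : Plane, 0 < Real.sin (EuclideanGeometry.angle P Q R) →
      0 < EuclideanGeometry.angle P Q R := by
    intro P Q R h
    refine (EuclideanGeometry.angle_nonneg _ _ _).lt_of_ne fun h0 => ?_
    rw [← h0, Real.sin_zero] at h
    exact h.false
  refine ⟨hx ▸ pos _ _ _ (hx ▸ sx), hy ▸ pos _ _ _ (hy ▸ sy), hz ▸ pos _ _ _ (hz ▸ sz),
    by linarith, dist (T.points (σ 1)) (T.points (σ 2)) / Real.sin x, ?_, σ, ?_, ?_, ?_⟩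
  · exact div_pos (dist_pos.2 (T.independent.injective.ne h12)) sx
  · field_simp
  · rw [dist_comm (T.points (σ 0))] at l1
    rw [dist_comm (T.points (σ 1)) (T.points (σ 2))]
    field_simp
    linarith
  · rw [dist_comm (T.points (σ 0)) (T.points (σ 2))] at l1
    have e1 : dist (T.points (σ 2)) (T.points (σ 0)) =
        dist (T.points (σ 1)) (T.points (σ 2)) * Real.sin y / Real.sin x := by
      rw [dist_comm (T.points (σ 1)) (T.points (σ 2))]
      field_simp
      linarith
    have e2 : dist (T.points (σ 0)) (T.points (σ 1)) =
        dist (T.points (σ 2)) (T.points (σ 0)) * Real.sin z / Real.sin y := by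
      rw [dist_comm (T.points (σ 2)) (T.points (σ 0))]
      rw [dist_comm (T.points (σ 1)) (T.points (σ 0))] at l2
      field_simp
      rw [dist_comm (T.points (σ 0)) (T.points (σ 2))]
      rw [dist_comm (T.points (σ 0)) (T.points (σ 2))] at *
      linarith
    rw [e2, e1]
    field_simp

/-- Here `cos A = 1 - s²/2`, so `sin 2A / sin A = 2 - s²` and `sin 3A / sin A = 4cos²A - 1 = (1 -
s²)(3 - s²)`. The bound `s < 1` is `A/2 < π/6`. -/
lemma hasSides_of_hasAngles_two_mul {T : PlaneTriangle} {A s : ℝ}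
    (h : T.HasAngles A (2 * A) (Real.pi - 3 * A)) (hs : s = 2 * Real.sin (A / 2)) :
    0 < s ∧ s < 1 ∧ ∃ l, 0 < l ∧ T.HasSides l (l * (2 - s ^ 2))
      (l * ((1 - s ^ 2) * (3 - s ^ 2))) := by
  obtain ⟨hA, -, hA3, -, d, hd, hT⟩ := h.hasSides
  have hpi := Real.pi_pos
  have hsA : 0 < Real.sin A := Real.sin_pos_of_pos_of_lt_pi hA (by linarith)
  have hcos : Real.cos A = 1 - s ^ 2 / 2 := by
    rw [hs, show A = 2 * (A / 2) by ring, Real.cos_two_mul, Real.cos_sq']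
    ring_nf
  refine ⟨?_, ?_, d * Real.sin A, by positivity, ?_⟩
  · rw [hs]
    have := Real.sin_pos_of_pos_of_lt_pi (x := A / 2) (by linarith) (by linarith)
    positivity
  · rw [hs]
    have := Real.sin_lt_sin_of_lt_of_le_pi_div_two (x := A / 2) (y := Real.pi / 6)
      (by linarith) (by linarith) (by linarith)
    rw [Real.sin_pi_div_six] at this
    linarith
  · convert hT using 1
    · rw [Real.sin_two_mul, hcos]; ring
    · rw [Real.sin_pi_sub, Real.sin_three_mul]
      have : Real.sin A ^ 3 = Real.sin A * (1 - Real.cos A ^ 2) := by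
        rw [← Real.sin_sq]; ring
      rw [this, hcos]; ring

/-- Since `β = π/2 - 3A/2` and `γ = π/2 + A/2`, the three sines share the factor `cos(A/2)`, which
is absorbed into `r`. -/
lemma hasSides_of_hasAngles_tile {R : PlaneTriangle} {A β γ s : ℝ}
    (h : R.HasAngles A β γ) (hβ : 3 * A + 2 * β = Real.pi) (hs : s = 2 * Real.sin (A / 2)) :
    ∃ r, 0 < r ∧ R.HasSides (r * s) (r * (1 - s ^ 2)) r := by
  obtain ⟨hA, hB, hC, hsum, d, hd, hR⟩ := h.hasSides
  have hc : 0 < Real.cos (A / 2) :=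
    Real.cos_pos_of_mem_Ioo ⟨by linarith, by linarith⟩
  refine ⟨d * Real.cos (A / 2), by positivity, ?_⟩
  convert hR using 1
  · rw [hs, show A = 2 * (A / 2) by ring, Real.sin_two_mul]; ring_nf
  · rw [show β = Real.pi / 2 - 3 * (A / 2) by linarith, Real.sin_pi_div_two_sub,
      Real.cos_three_mul, hs]
    have : Real.cos (A / 2) ^ 3 = Real.cos (A / 2) * (1 - Real.sin (A / 2) ^ 2) := by
      rw [← Real.cos_sq']; ring
    rw [this]; ring
  · rw [show γ = Real.pi / 2 + A / 2 by linarith, Real.sin_add, Real.sin_pi_div_two,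
      Real.cos_pi_div_two]
    ring

end PlaneTriangle

/-! ### Arithmetic of the number of tiles. -/

/-- `-1` is not a square modulo `3`. -/
lemma three_dvd_of_sq_add_sq {x y : ℤ} (h : (3 : ℤ) ∣ x ^ 2 + y ^ 2) : (3 : ℤ) ∣ x ∧ (3 : ℤ) ∣ y := by
  have key : ∀ a b : ZMod 3, a ^ 2 + b ^ 2 = 0 → a = 0 ∧ b = 0 := by decide
  have h3 := (ZMod.intCast_zmod_eq_zero_iff_dvd (x ^ 2 + y ^ 2) 3).2 (by exact_mod_cast h)
  push_cast at h3
  obtain ⟨h1, h2⟩ := key _ _ h3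
  exact ⟨by exact_mod_cast (ZMod.intCast_zmod_eq_zero_iff_dvd x 3).1 h1,
    by exact_mod_cast (ZMod.intCast_zmod_eq_zero_iff_dvd y 3).1 h2⟩

lemma not_isSquare_two_mul_sub_mul_three_mul_sub {p q : ℤ} (hpq : IsCoprime p q)
    (hlt : p ^ 2 < 3 * q ^ 2) (r : ℤ) : (2 * q ^ 2 - p ^ 2) * (3 * q ^ 2 - p ^ 2) ≠ r ^ 2 := by
  intro h
  have hc : IsCoprime (2 * q ^ 2 - p ^ 2) (3 * q ^ 2 - p ^ 2) := by
    obtain ⟨u, v, huv⟩ : IsCoprime (p ^ 2) (q ^ 2) := hpq.pow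
    exact ⟨-3 * u - v, 2 * u + v, by linear_combination huv⟩
  -- Each of two coprime factors of a square is a square up to sign; `hlt` rules out the minus sign.
  obtain ⟨v, hv⟩ := Int.sq_of_isCoprime hc.symm (c := r) (by linarith)
  have hv' : 3 * q ^ 2 - p ^ 2 = v ^ 2 := by
    rcases hv with hv | hv
    · exact hv
    · nlinarith [sq_nonneg v]
  -- From `p² + v² = 3q²` both `p` and `v` are multiples of 3; then `q² = 3(p'² + v'²)`, so 3
  -- divides `q` as well.
  obtain ⟨⟨p', rfl⟩, ⟨v', rfl⟩⟩ := three_dvd_of_sq_add_sq (x := p) (y := v)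
    ⟨q ^ 2, by linarith⟩
  have hq : (3 : ℤ) ∣ q := Int.prime_three.dvd_of_dvd_pow (n := 2) ⟨p' ^ 2 + v' ^ 2, by linarith⟩
  have := hpq.isUnit_of_dvd' (Dvd.intro _ rfl) hq
  exact Int.prime_three.not_isUnit this

/-- The arithmetic of the number of tiles, in terms of two sides of the tiled triangle. -/
lemma tile_count_arithmetic {s κ : ℝ} {σ : ℚ} (hσ : s = σ) (hs0 : 0 < s) (hs1 : s < 1)
    (hκ : 0 < κ) {l m n l' m' n' N : ℕ} (h1 : κ = l * s + m * (1 - s ^ 2) + n)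
    (h2 : κ * ((1 - s ^ 2) * (3 - s ^ 2)) = l' * s + m' * (1 - s ^ 2) + n')
    (hN : (N : ℝ) = κ ^ 2 * ((2 - s ^ 2) * (3 - s ^ 2))) :
    (∃ M : ℤ, (N : ℝ) = (M : ℝ) ^ 2 * ((2 - s ^ 2) * (3 - s ^ 2)) / ((1 - s) ^ 2 * (2 + s) ^ 2)) ∧
      ¬ IsSquare N := by
  obtain ⟨p, q, hq, hpq, hsq⟩ : ∃ p q : ℤ, 0 < q ∧ IsCoprime p q ∧ s = p / q :=
    ⟨σ.num, σ.den, by exact_mod_cast σ.den_pos, Int.isCoprime_iff_gcd_eq_one.2 σ.reduced, by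
      rw [hσ]; exact_mod_cast (Rat.num_div_den σ).symm⟩
  have hqR : (0 : ℝ) < q := by exact_mod_cast hq
  have hp : (p : ℝ) = s * q := by rw [hsq]; field_simp
  set k : ℤ := l * p * q + m * (q ^ 2 - p ^ 2) + n * q ^ 2 with hk
  set k' : ℤ := l' * p * q + m' * (q ^ 2 - p ^ 2) + n' * q ^ 2 with hk'
  have hkR : (k : ℝ) = κ * q ^ 2 := by
    rw [hk, h1]; push_cast; rw [hp]; ring
  have hkR' : (k' : ℝ) = κ * ((1 - s ^ 2) * (3 - s ^ 2)) * q ^ 2 := by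
    rw [hk', h2]; push_cast; rw [hp]; ring
  have hkk : k * ((q ^ 2 - p ^ 2) * (3 * q ^ 2 - p ^ 2)) = k' * q ^ 4 := by
    have : (k : ℝ) * ((q ^ 2 - p ^ 2) * (3 * q ^ 2 - p ^ 2)) = k' * q ^ 4 := by
      rw [hkR, hkR', hp]; ring
    exact_mod_cast this
  have hc : IsCoprime (q ^ 4) ((q ^ 2 - p ^ 2) * (3 * q ^ 2 - p ^ 2)) := by
    refine IsCoprime.pow_left ?_
    have h0 : IsCoprime q (-(p ^ 2)) := (hpq.symm.pow_right).neg_right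
    have h3 : IsCoprime q (-(p ^ 2) + q * q) := h0.add_mul_left_right q
    have h4 : IsCoprime q (-(p ^ 2) + q * (3 * q)) := h0.add_mul_left_right (3 * q)
    convert! h3.mul_right h4 using 1
    ring
  -- Modulo `q` the factors `q² - p²` and `3q² - p²` are both `-p²`, so they are prime to `q`, and
  -- the whole power `q⁴` has to divide `k = κq²`.
  obtain ⟨j, hj⟩ : q ^ 4 ∣ k := hc.dvd_of_dvd_mul_right ⟨k', by linarith⟩
  have hκj : κ = q ^ 2 * j := by
    have : κ * q ^ 2 = q ^ 4 * j := by rw [← hkR, hj]; push_cast; ring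
    have h5 : (q : ℝ) ^ 2 ≠ 0 := by positivity
    apply mul_right_cancel₀ h5
    linarith
  -- `M = κ(1 - s)(2 + s)`, an integer because `κ = q²j`.
  refine ⟨⟨j * ((q - p) * (2 * q + p)), ?_⟩, ?_⟩
  · have h6 : (1 - s) ≠ 0 := by linarith
    have h7 : (2 + s) ≠ 0 := by linarith
    rw [hN, hκj]
    push_cast
    rw [hp]
    field_simp
  · rintro ⟨r, hr⟩
    have hNj : (N : ℤ) = j ^ 2 * ((2 * q ^ 2 - p ^ 2) * (3 * q ^ 2 - p ^ 2)) := by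
      have : (N : ℝ) = j ^ 2 * ((2 * q ^ 2 - p ^ 2) * (3 * q ^ 2 - p ^ 2)) := by
        rw [hN, hκj, hp]; ring
      exact_mod_cast this
    have hj0 : j ≠ 0 := by
      rintro rfl
      simp at hκj
      exact hκ.ne' hκj
    have hr2 : (r : ℤ) ^ 2 = j ^ 2 * ((2 * q ^ 2 - p ^ 2) * (3 * q ^ 2 - p ^ 2)) := by
      rw [← hNj, hr]; push_cast; ring
    obtain ⟨c, hc⟩ : j ∣ r := (Int.pow_dvd_pow_iff two_ne_zero).1 ⟨_, hr2⟩
    refine not_isSquare_two_mul_sub_mul_three_mul_sub hpq ?_ c ?_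
    · have : (p : ℝ) ^ 2 < 3 * q ^ 2 := by
        rw [hp]
        have : s ^ 2 < 1 := by nlinarith
        nlinarith [sq_nonneg (q : ℝ), mul_pos hqR hqR]
      exact_mod_cast this
    · rw [hc, mul_pow] at hr2
      exact (mul_left_cancel₀ (pow_ne_zero 2 hj0) hr2).symm

namespace PlaneTriangle

lemma TilesInto.count {T R : PlaneTriangle} {N : ℕ} {s l r : ℝ} {σ : ℚ} (hσ : s = σ)
    (hs0 : 0 < s) (hs1 : s < 1) (hl : 0 < l) (hr : 0 < r)
    (hT : T.HasSides l (l * (2 - s ^ 2)) (l * ((1 - s ^ 2) * (3 - s ^ 2))))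
    (hR : R.HasSides (r * s) (r * (1 - s ^ 2)) r) (h : T.TilesInto R N) :
    (∃ M : ℤ, (N : ℝ) = (M : ℝ) ^ 2 * ((2 - s ^ 2) * (3 - s ^ 2)) / ((1 - s) ^ 2 * (2 + s) ^ 2)) ∧
      ¬ IsSquare N := by
  obtain ⟨t, ht⟩ := h
  have hs2 : s ^ 2 < 1 := by nlinarith
  have hdR := four_mul_det_sq _ _ _ _ hR
  have hdT := four_mul_det_sq _ _ _ _ hT
  have hNR := ht.card_mul_abs_det
  have hN : (N : ℝ) = (l / r) ^ 2 * ((2 - s ^ 2) * (3 - s ^ 2)) := by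
    have hsq : (N : ℝ) ^ 2 * R.det ^ 2 = T.det ^ 2 := by
      rw [← sq_abs R.det, ← sq_abs T.det, ← hNR]; ring
    have hpos : 0 < 4 * R.det ^ 2 := by
      have h1 : 0 < 1 - s ^ 2 := by linarith
      have h2 : 0 < 4 - s ^ 2 := by linarith
      -- Heron's polynomial factors completely for the sides `rs`, `r(1 - s²)`, `r`.
      calc 0 < r ^ 4 * s ^ 2 * (1 - s ^ 2) ^ 2 * (4 - s ^ 2) := by positivity
        _ = 4 * R.det ^ 2 := by rw [hdR]; ring
    have h1 : (N : ℝ) ^ 2 = ((l / r) ^ 2 * ((2 - s ^ 2) * (3 - s ^ 2))) ^ 2 := by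
      apply mul_right_cancel₀ hpos.ne'
      rw [show (N : ℝ) ^ 2 * (4 * R.det ^ 2) = 4 * (N ^ 2 * R.det ^ 2) by ring, hsq, hdT, hdR]
      field_simp
      ring
    have h2 : 0 < (2 - s ^ 2) * (3 - s ^ 2) := mul_pos (by linarith) (by linarith)
    exact (pow_left_inj₀ (by positivity) (by positivity) two_ne_zero).1 h1
  obtain ⟨τ, h1, h2, h3⟩ := hT
  -- The sides `l` and `l(1 - s²)(3 - s²)` are used: their ratio has denominator `q⁴`, as the
  -- divisibility argument requires.
  obtain ⟨a, b, c, e1⟩ := ht.dist_eq_sum hR (i := τ 1) (j := τ 2) (by simp)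
  obtain ⟨a', b', c', e2⟩ := ht.dist_eq_sum hR (i := τ 0) (j := τ 1) (by simp)
  rw [h1] at e1
  rw [h3] at e2
  refine tile_count_arithmetic hσ hs0 hs1 (div_pos hl hr) (l := a) (m := b) (n := c)
    (l' := a') (m' := b') (n' := c') ?_ ?_ hN
  · rw [e1]; field_simp
  · rw [div_mul_eq_mul_div, e2]; field_simp

/-! ### Dissections, and regions in an affine frame. -/

/-- `S` is a finite union of triangles with property `P` that overlap only at their boundaries. -/
inductive Dissects (P : PlaneTriangle → Prop) : Set Plane → Prop
  | triangle (t : PlaneTriangle) : P t → Dissects P t.closedInterior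
  | union {S S' : Set Plane} : Dissects P S → Dissects P S' → interior (S ∩ S') = ∅ →
      Dissects P (S ∪ S')

namespace Dissects

variable {P Q : PlaneTriangle → Prop} {S : Set Plane}

lemma bind (h : Dissects P S) (hPQ : ∀ t, P t → Dissects Q t.closedInterior) : Dissects Q S := by
  induction h with
  | triangle t ht => exact hPQ t ht
  | union _ _ hd h1 h2 => exact h1.union h2 hd

lemma exists_fin (h : Dissects P S) : ∃ (N : ℕ) (t : Fin N → PlaneTriangle), (∀ i, P (t i)) ∧
    ⋃ i, (t i).closedInterior = S ∧
    ∀ i j, i ≠ j → Disjoint (t i).interior (t j).interior := by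
  induction h with
  | triangle t ht =>
    exact ⟨1, fun _ => t, fun _ => ht, Set.iUnion_const _,
      fun i j hij => absurd (Subsingleton.elim i j) hij⟩
  | @union S S' _ _ hd h1 h2 =>
    obtain ⟨N, t, hP, hS, ht⟩ := h1
    obtain ⟨N', t', hP', hS', ht'⟩ := h2
    -- Two such interiors meet in the interior of an intersection contained in `S ∩ S'`, which is
    -- empty.
    have hx : ∀ i j, Disjoint (t i).interior (t' j).interior := by
      intro i j
      rw [Set.disjoint_iff_inter_eq_empty, interior_eq, interior_eq, ← interior_inter,
        ← Set.subset_empty_iff, ← hd, ← hS, ← hS']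
      exact interior_mono (Set.inter_subset_inter (Set.subset_iUnion_of_subset i le_rfl)
        (Set.subset_iUnion_of_subset j le_rfl))
    refine ⟨N + N', Fin.append t t', ?_, ?_, ?_⟩
    · intro i
      induction i using Fin.addCases with
      | left i => simpa using hP i
      | right i => simpa using hP' i
    · rw [← hS, ← hS']
      ext x
      simp only [Set.mem_iUnion, Set.mem_union]
      constructor
      · rintro ⟨i, hi⟩
        induction i using Fin.addCases with
        | left i => exact Or.inl ⟨i, by simpa using hi⟩
        | right i => exact Or.inr ⟨i, by simpa using hi⟩
      · rintro (⟨i, hi⟩ | ⟨i, hi⟩)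
        · exact ⟨Fin.castAdd N' i, by simpa using hi⟩
        · exact ⟨Fin.natAdd N i, by simpa using hi⟩
    · intro i j hij
      induction i using Fin.addCases with
      | left i =>
        induction j using Fin.addCases with
        | left j =>
          simpa using ht i j (by rintro rfl; exact hij rfl)
        | right j => simpa using hx i j
      | right i =>
        induction j using Fin.addCases with
        | left j => simpa using (hx j i).symm
        | right j => simpa using ht' i j (by rintro rfl; exact hij rfl)

end Dissects

/-- The set of points whose coordinates in the frame `(O; u, v)` satisfy `S`. -/
def region (O u v : Plane) (S : ℝ → ℝ → Prop) : Set Plane :=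
  {z | ∃ x y, S x y ∧ z = O + x • u + y • v}

section frame

variable {O u v : Plane} {P : PlaneTriangle → Prop}

lemma frame_injective (hi : LinearIndependent ℝ ![u, v]) {x y x' y' : ℝ}
    (h : O + x • u + y • v = O + x' • u + y' • v) : x = x' ∧ y = y' := by
  rw [LinearIndependent.pair_iff] at hi
  have := hi (x - x') (y - y') (by
    rw [← sub_eq_zero.2 h]; module)
  exact ⟨sub_eq_zero.1 this.1, sub_eq_zero.1 this.2⟩

/-- A small move along the normal `(c, d)` leaves the line. -/
lemma interior_line_eq_empty {c d : ℝ} (e : ℝ) (h : c ≠ 0 ∨ d ≠ 0) :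
    interior {p : ℝ × ℝ | c * p.1 + d * p.2 = e} = ∅ := by
  by_contra hne
  obtain ⟨p, hp⟩ := Set.nonempty_iff_ne_empty.2 hne
  have hcont : Continuous fun t : ℝ => (p.1 + t * c, p.2 + t * d) := by fun_prop
  have hev : ∀ᶠ t in nhds (0 : ℝ), (p.1 + t * c, p.2 + t * d) ∈
      interior {p : ℝ × ℝ | c * p.1 + d * p.2 = e} := by
    refine hcont.continuousAt.eventually_mem ?_
    simpa using isOpen_interior.mem_nhds hp
  obtain ⟨t, ht, ht0⟩ := ((hev.filter_mono nhdsWithin_le_nhds).and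
    (self_mem_nhdsWithin : ∀ᶠ t in nhdsWithin (0 : ℝ) {0}ᶜ, t ∈ ({0}ᶜ : Set ℝ))).exists
  replace ht := interior_subset ht
  replace hp := interior_subset hp
  simp only [Set.mem_ofPred_eq] at ht hp
  have h3 : t * (c ^ 2 + d ^ 2) = 0 := by linear_combination ht - hp
  have h4 : 0 < c ^ 2 + d ^ 2 := by rcases h with h | h <;> positivity
  exact (mul_ne_zero ht0 h4.ne') h3

/-- Gluing two regions whose intersection lies on two lines. -/
lemma Dissects.glue₂ (hi : LinearIndependent ℝ ![u, v]) {S₁ S₂ S : ℝ → ℝ → Prop}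
    (h₁ : Dissects P (region O u v S₁)) (h₂ : Dissects P (region O u v S₂))
    (c d e c' d' e' : ℝ) (hcd : c ≠ 0 ∨ d ≠ 0) (hcd' : c' ≠ 0 ∨ d' ≠ 0)
    (hS : ∀ x y, S x y ↔ S₁ x y ∨ S₂ x y)
    (hsep : ∀ x y, S₁ x y → S₂ x y → c * x + d * y = e ∨ c' * x + d' * y = e') :
    Dissects P (region O u v S) := by
  have hu : region O u v S = region O u v S₁ ∪ region O u v S₂ := by
    ext z
    simp only [region, Set.mem_union, Set.mem_ofPred_eq, hS, or_and_right, exists_or]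
  rw [hu]
  refine h₁.union h₂ ?_
  by_contra hne
  obtain ⟨z, hz⟩ := Set.nonempty_iff_ne_empty.2 hne
  let F : ℝ × ℝ → Plane := fun p => O + p.1 • u + p.2 • v
  have hF : Continuous F := by fun_prop
  -- Pulled back to coordinates, the interior of the overlap is an open set inside two lines, hence
  -- empty.
  have hsub : F ⁻¹' interior (region O u v S₁ ∩ region O u v S₂) ⊆
      interior ({p : ℝ × ℝ | c * p.1 + d * p.2 = e} ∪ {p : ℝ × ℝ | c' * p.1 + d' * p.2 = e'}) := by
    refine interior_maximal ?_ (isOpen_interior.preimage hF)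
    rintro ⟨x, y⟩ hp
    obtain ⟨⟨x₁, y₁, h1, e1⟩, ⟨x₂, y₂, h2, e2⟩⟩ := interior_subset hp
    obtain ⟨rfl, rfl⟩ := frame_injective hi e1
    obtain ⟨rfl, rfl⟩ := frame_injective hi e2
    exact hsep _ _ h1 h2
  rw [interior_union_isClosed_of_interior_empty
    (isClosed_eq (by fun_prop) continuous_const) (interior_line_eq_empty _ hcd'),
    interior_line_eq_empty _ hcd] at hsub
  obtain ⟨⟨x, y, -, e1⟩, -⟩ := interior_subset hz
  exact hsub (show (x, y) ∈ F ⁻¹' _ by simp only [Set.mem_preimage, F]; rw [← e1]; exact hz)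

/-- Gluing two regions whose intersection lies on a line. -/
lemma Dissects.glue (hi : LinearIndependent ℝ ![u, v]) {S₁ S₂ S : ℝ → ℝ → Prop}
    (h₁ : Dissects P (region O u v S₁)) (h₂ : Dissects P (region O u v S₂))
    (c d e : ℝ) (hcd : c ≠ 0 ∨ d ≠ 0)
    (hS : ∀ x y, S x y ↔ S₁ x y ∨ S₂ x y)
    (hsep : ∀ x y, S₁ x y → S₂ x y → c * x + d * y = e) :
    Dissects P (region O u v S) :=
  h₁.glue₂ hi h₂ c d e c d e hcd hcd hS fun x y hx hy => Or.inl (hsep x y hx hy)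

/-- The triangle with given coordinates in a frame. -/
lemma exists_triangle_of_frame (O : Plane) (hi : LinearIndependent ℝ ![u, v])
    {x₀ y₀ x₁ y₁ x₂ y₂ : ℝ}
    (hD : (x₁ - x₀) * (y₂ - y₀) - (y₁ - y₀) * (x₂ - x₀) ≠ 0) :
    ∃ t : PlaneTriangle, t.points 0 = O + x₀ • u + y₀ • v ∧ t.points 1 = O + x₁ • u + y₁ • v ∧
      t.points 2 = O + x₂ • u + y₂ • v := by
  refine ⟨⟨![O + x₀ • u + y₀ • v, O + x₁ • u + y₁ • v, O + x₂ • u + y₂ • v], ?_⟩, rfl, rfl, rfl⟩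
  rw [affineIndependent_iff_of_fintype]
  intro w hw h
  rw [Finset.weightedVSub_eq_linear_combination _ hw, Fin.sum_univ_three] at h
  rw [Fin.sum_univ_three] at hw
  simp only [Matrix.cons_val_zero, Matrix.cons_val_one, Matrix.cons_val] at h
  obtain ⟨h1, h2⟩ := LinearIndependent.pair_iff.1 hi
    (w 0 * x₀ + w 1 * x₁ + w 2 * x₂) (w 0 * y₀ + w 1 * y₁ + w 2 * y₂) (by
      rw [← h, ← sub_eq_zero]
      have : (w 0 + w 1 + w 2) • O = 0 := by rw [hw, zero_smul]
      rw [← neg_eq_zero, ← this]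
      module)
  have e1 : w 1 = 0 := by
    apply mul_right_cancel₀ hD
    linear_combination (y₂ - y₀) * h1 - (x₂ - x₀) * h2 - (x₀ * y₂ - y₀ * x₂) * hw
  have e2 : w 2 = 0 := by
    apply mul_right_cancel₀ hD
    linear_combination -(y₁ - y₀) * h1 + (x₁ - x₀) * h2 + (x₀ * y₁ - y₀ * x₁) * hw
  have e0 : w 0 = 0 := by linarith
  intro i
  fin_cases i <;> assumption

/-- Evaluating the two linear forms on the two edge vectors gives a matrix whose determinant is a
product of positive diagonal terms. It is also the determinant of the forms times that of the edges,
so the latter cannot vanish. -/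
lemma det_ne_zero_of_lines {x₀ y₀ x₁ y₁ x₂ y₂ c₁ d₁ e₁ c₂ d₂ e₂ : ℝ}
    (h10 : c₁ * x₀ + d₁ * y₀ + e₁ = 0) (h11 : 0 < c₁ * x₁ + d₁ * y₁ + e₁)
    (h12 : c₁ * x₂ + d₁ * y₂ + e₁ = 0)
    (h20 : c₂ * x₀ + d₂ * y₀ + e₂ = 0)
    (h22 : 0 < c₂ * x₂ + d₂ * y₂ + e₂) :
    (x₁ - x₀) * (y₂ - y₀) - (y₁ - y₀) * (x₂ - x₀) ≠ 0 := by
  intro hD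
  have key : (c₁ * (x₁ - x₀) + d₁ * (y₁ - y₀)) * (c₂ * (x₂ - x₀) + d₂ * (y₂ - y₀)) -
      (c₁ * (x₂ - x₀) + d₁ * (y₂ - y₀)) * (c₂ * (x₁ - x₀) + d₂ * (y₁ - y₀)) =
      (c₁ * d₂ - d₁ * c₂) * ((x₁ - x₀) * (y₂ - y₀) - (y₁ - y₀) * (x₂ - x₀)) := by ring
  have a1 : c₁ * (x₁ - x₀) + d₁ * (y₁ - y₀) = c₁ * x₁ + d₁ * y₁ + e₁ := by linarith
  have a2 : c₂ * (x₂ - x₀) + d₂ * (y₂ - y₀) = c₂ * x₂ + d₂ * y₂ + e₂ := by linarith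
  have a3 : c₁ * (x₂ - x₀) + d₁ * (y₂ - y₀) = 0 := by linarith
  rw [hD, a1, a2, a3] at key
  have := mul_pos h11 h22
  linarith

/-- A region bounded by three lines, with the vertices of the triangle given. -/
lemma region_eq_closedInterior (t : PlaneTriangle)
    {S : ℝ → ℝ → Prop} {x₀ y₀ x₁ y₁ x₂ y₂ : ℝ}
    (t0 : t.points 0 = O + x₀ • u + y₀ • v) (t1 : t.points 1 = O + x₁ • u + y₁ • v)
    (t2 : t.points 2 = O + x₂ • u + y₂ • v) (c₀ d₀ e₀ c₁ d₁ e₁ c₂ d₂ e₂ : ℝ)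
    (hS : ∀ x y, S x y ↔ 0 ≤ c₀ * x + d₀ * y + e₀ ∧ 0 ≤ c₁ * x + d₁ * y + e₁ ∧
      0 ≤ c₂ * x + d₂ * y + e₂)
    (h00 : 0 < c₀ * x₀ + d₀ * y₀ + e₀) (h01 : c₀ * x₁ + d₀ * y₁ + e₀ = 0)
    (h02 : c₀ * x₂ + d₀ * y₂ + e₀ = 0)
    (h10 : c₁ * x₀ + d₁ * y₀ + e₁ = 0) (h11 : 0 < c₁ * x₁ + d₁ * y₁ + e₁)
    (h12 : c₁ * x₂ + d₁ * y₂ + e₁ = 0)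
    (h20 : c₂ * x₀ + d₂ * y₀ + e₂ = 0) (h21 : c₂ * x₁ + d₂ * y₁ + e₂ = 0)
    (h22 : 0 < c₂ * x₂ + d₂ * y₂ + e₂) :
    region O u v S = t.closedInterior := by
  have hD := det_ne_zero_of_lines h10 h11 h12 h20 h22
  ext z
  rw [mem_closedInterior_iff_exists, t0, t1, t2]
  constructor
  · rintro ⟨x, y, hxy, rfl⟩
    obtain ⟨k0, k1, k2⟩ := (hS x y).1 hxy
    set D := (x₁ - x₀) * (y₂ - y₀) - (y₁ - y₀) * (x₂ - x₀) with hDdef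
    obtain ⟨a, ha⟩ : ∃ a, a * D = (x - x₀) * (y₂ - y₀) - (y - y₀) * (x₂ - x₀) :=
      ⟨_, div_mul_cancel₀ _ hD⟩
    obtain ⟨b, hb⟩ : ∃ b, b * D = (x₁ - x₀) * (y - y₀) - (y₁ - y₀) * (x - x₀) :=
      ⟨_, div_mul_cancel₀ _ hD⟩
    have hx : x = x₀ + a * (x₁ - x₀) + b * (x₂ - x₀) := by
      apply mul_right_cancel₀ hD
      linear_combination -(x₁ - x₀) * ha - (x₂ - x₀) * hb + x * hDdef - x₀ * hDdef
    have hy : y = y₀ + a * (y₁ - y₀) + b * (y₂ - y₀) := by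
      apply mul_right_cancel₀ hD
      linear_combination -(y₁ - y₀) * ha - (y₂ - y₀) * hb + y * hDdef - y₀ * hDdef
    have g0 : c₀ * x + d₀ * y + e₀ = (1 - a - b) * (c₀ * x₀ + d₀ * y₀ + e₀) := by
      rw [hx, hy]; linear_combination a * h01 + b * h02
    have g1 : c₁ * x + d₁ * y + e₁ = a * (c₁ * x₁ + d₁ * y₁ + e₁) := by
      rw [hx, hy]; linear_combination (1 - a - b) * h10 + b * h12
    have g2 : c₂ * x + d₂ * y + e₂ = b * (c₂ * x₂ + d₂ * y₂ + e₂) := by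
      rw [hx, hy]; linear_combination (1 - a - b) * h20 + a * h21
    rw [g0] at k0
    rw [g1] at k1
    rw [g2] at k2
    refine ⟨a, b, nonneg_of_mul_nonneg_left k1 h11, nonneg_of_mul_nonneg_left k2 h22, ?_, ?_⟩
    · linarith [nonneg_of_mul_nonneg_left k0 h00]
    · rw [hx, hy]; module
  · rintro ⟨a, b, ha, hb, hab, rfl⟩
    refine ⟨x₀ + a * (x₁ - x₀) + b * (x₂ - x₀), y₀ + a * (y₁ - y₀) + b * (y₂ - y₀),
      (hS _ _).2 ⟨?_, ?_, ?_⟩, by module⟩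
    · calc (0 : ℝ) ≤ (1 - a - b) * (c₀ * x₀ + d₀ * y₀ + e₀) :=
            mul_nonneg (by linarith) h00.le
        _ = _ := by linear_combination -a * h01 - b * h02
    · calc (0 : ℝ) ≤ a * (c₁ * x₁ + d₁ * y₁ + e₁) := mul_nonneg ha h11.le
        _ = _ := by linear_combination -(1 - a - b) * h10 - b * h12
    · calc (0 : ℝ) ≤ b * (c₂ * x₂ + d₂ * y₂ + e₂) := mul_nonneg hb h22.le
        _ = _ := by linear_combination -(1 - a - b) * h20 - a * h21

lemma dissects_region_triangle (hi : LinearIndependent ℝ ![u, v]) {S : ℝ → ℝ → Prop}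
    {x₀ y₀ x₁ y₁ x₂ y₂ : ℝ} (c₀ d₀ e₀ c₁ d₁ e₁ c₂ d₂ e₂ : ℝ)
    (hS : ∀ x y, S x y ↔ 0 ≤ c₀ * x + d₀ * y + e₀ ∧ 0 ≤ c₁ * x + d₁ * y + e₁ ∧
      0 ≤ c₂ * x + d₂ * y + e₂)
    (h00 : 0 < c₀ * x₀ + d₀ * y₀ + e₀) (h01 : c₀ * x₁ + d₀ * y₁ + e₀ = 0)
    (h02 : c₀ * x₂ + d₀ * y₂ + e₀ = 0)
    (h10 : c₁ * x₀ + d₁ * y₀ + e₁ = 0) (h11 : 0 < c₁ * x₁ + d₁ * y₁ + e₁)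
    (h12 : c₁ * x₂ + d₁ * y₂ + e₁ = 0)
    (h20 : c₂ * x₀ + d₂ * y₀ + e₂ = 0) (h21 : c₂ * x₁ + d₂ * y₁ + e₂ = 0)
    (h22 : 0 < c₂ * x₂ + d₂ * y₂ + e₂)
    (hP : ∀ t : PlaneTriangle, t.points 0 = O + x₀ • u + y₀ • v →
      t.points 1 = O + x₁ • u + y₁ • v → t.points 2 = O + x₂ • u + y₂ • v → P t) :
    Dissects P (region O u v S) := by
  obtain ⟨t, t0, t1, t2⟩ :=
    exists_triangle_of_frame O hi (det_ne_zero_of_lines h10 h11 h12 h20 h22)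
  rw [region_eq_closedInterior t t0 t1 t2 c₀ d₀ e₀ c₁ d₁ e₁ c₂ d₂ e₂ hS h00 h01 h02 h10 h11 h12
    h20 h21 h22]
  exact .triangle t (hP t t0 t1 t2)

end frame

lemma dist_frame (O u v : Plane) {x y x' y' L : ℝ} (hL : 0 ≤ L)
    (h : (x - x') ^ 2 * ‖u‖ ^ 2 + 2 * ((x - x') * (y - y')) * inner ℝ u v +
      (y - y') ^ 2 * ‖v‖ ^ 2 = L ^ 2) :
    dist (O + x • u + y • v) (O + x' • u + y' • v) = L := by
  rw [dist_eq_norm, show O + x • u + y • v - (O + x' • u + y' • v) =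
    (x - x') • u + (y - y') • v by module]
  refine (pow_left_inj₀ (norm_nonneg _) hL two_ne_zero).1 ?_
  rw [norm_add_sq_real, ← h, inner_smul_left, inner_smul_right, norm_smul, norm_smul, mul_pow,
    mul_pow, Real.norm_eq_abs, Real.norm_eq_abs, sq_abs, sq_abs]
  simp only [conj_trivial]
  ring

/-! ### Lattice tilings by translates and point reflections of one triangle. -/

section lattice

variable {O u v : Plane} {P : PlaneTriangle → Prop}

lemma dissects_lattice_up (hi : LinearIndependent ℝ ![u, v])
    (hP : ∀ t : PlaneTriangle, dist (t.points 0) (t.points 1) = ‖u‖ →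
      dist (t.points 0) (t.points 2) = ‖v‖ → dist (t.points 1) (t.points 2) = ‖u - v‖ → P t)
    (i j : ℝ) : Dissects P (region O u v fun x y => i ≤ x ∧ j ≤ y ∧ x + y ≤ i + j + 1) := by
  refine dissects_region_triangle hi (x₀ := i) (y₀ := j) (x₁ := i + 1) (y₁ := j) (x₂ := i)
    (y₂ := j + 1) (-1) (-1) (i + j + 1) 1 0 (-i) 0 1 (-j) ?_ (by linarith) (by ring) (by ring)
    (by ring) (by linarith) (by ring) (by ring) (by ring) (by linarith) ?_
  · intro x y
    constructor
    · rintro ⟨h1, h2, h3⟩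
      refine ⟨?_, ?_, ?_⟩ <;> linarith
    · rintro ⟨h1, h2, h3⟩
      refine ⟨?_, ?_, ?_⟩ <;> linarith
  · intro t h0 h1 h2
    refine hP t ?_ ?_ ?_
    · rw [h0, h1]; exact dist_frame O u v (norm_nonneg _) (by ring)
    · rw [h0, h2]; exact dist_frame O u v (norm_nonneg _) (by ring)
    · rw [h1, h2]; exact dist_frame O u v (norm_nonneg _) (by rw [norm_sub_sq_real]; ring)

/-- The point reflection of an upward triangle: labelled from the corner `(i + 1, j + 1)` it has the
same three lengths, so the same `hP` applies. -/
lemma dissects_lattice_down (hi : LinearIndependent ℝ ![u, v])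
    (hP : ∀ t : PlaneTriangle, dist (t.points 0) (t.points 1) = ‖u‖ →
      dist (t.points 0) (t.points 2) = ‖v‖ → dist (t.points 1) (t.points 2) = ‖u - v‖ → P t)
    (i j : ℝ) :
    Dissects P (region O u v fun x y => x ≤ i + 1 ∧ y ≤ j + 1 ∧ i + j + 1 ≤ x + y) := by
  refine dissects_region_triangle hi (x₀ := i + 1) (y₀ := j + 1) (x₁ := i) (y₁ := j + 1)
    (x₂ := i + 1) (y₂ := j) 1 1 (-(i + j + 1)) (-1) 0 (i + 1) 0 (-1) (j + 1) ?_
    (by linarith) (by ring) (by ring)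
    (by ring) (by linarith) (by ring) (by ring) (by ring) (by linarith) ?_
  · intro x y
    constructor
    · rintro ⟨h1, h2, h3⟩
      refine ⟨?_, ?_, ?_⟩ <;> linarith
    · rintro ⟨h1, h2, h3⟩
      refine ⟨?_, ?_, ?_⟩ <;> linarith
  · intro t h0 h1 h2
    refine hP t ?_ ?_ ?_
    · rw [h0, h1]; exact dist_frame O u v (norm_nonneg _) (by ring)
    · rw [h0, h2]; exact dist_frame O u v (norm_nonneg _) (by ring)
    · rw [h1, h2]; exact dist_frame O u v (norm_nonneg _) (by rw [norm_sub_sq_real]; ring)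

lemma dissects_lattice_unit (hi : LinearIndependent ℝ ![u, v])
    (hP : ∀ t : PlaneTriangle, dist (t.points 0) (t.points 1) = ‖u‖ →
      dist (t.points 0) (t.points 2) = ‖v‖ → dist (t.points 1) (t.points 2) = ‖u - v‖ → P t)
    (i j : ℝ) :
    Dissects P (region O u v fun x y => (i ≤ x ∧ x ≤ i + 1) ∧ j ≤ y ∧ y ≤ j + 1) := by
  refine (dissects_lattice_up hi hP i j).glue hi (dissects_lattice_down hi hP i j)
    1 1 (i + j + 1) (by norm_num) ?_ ?_
  · intro x y
    constructor
    · rintro ⟨⟨h1, h2⟩, h3, h4⟩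
      rcases le_total (x + y) (i + j + 1) with h | h
      · exact Or.inl ⟨h1, h3, h⟩
      · exact Or.inr ⟨h2, h4, h⟩
    · rintro (⟨h1, h2, h3⟩ | ⟨h1, h2, h3⟩) <;>
        refine ⟨⟨?_, ?_⟩, ?_, ?_⟩ <;> linarith
  · rintro x y ⟨h1, h2, h3⟩ ⟨h4, h5, h6⟩
    linarith

lemma dissects_lattice_row (hi : LinearIndependent ℝ ![u, v])
    (hP : ∀ t : PlaneTriangle, dist (t.points 0) (t.points 1) = ‖u‖ →
      dist (t.points 0) (t.points 2) = ‖v‖ → dist (t.points 1) (t.points 2) = ‖u - v‖ → P t)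
    (i j : ℝ) (m : ℕ) :
    Dissects P (region O u v fun x y => (i ≤ x ∧ x ≤ i + (m + 1)) ∧ j ≤ y ∧ y ≤ j + 1) := by
  induction m with
  | zero => simpa using dissects_lattice_unit hi hP i j
  | succ m ih =>
    refine ih.glue hi (dissects_lattice_unit hi hP (i + (m + 1)) j) 1 0 (i + (m + 1))
      (by norm_num) ?_ ?_
    · intro x y
      push_cast
      constructor
      · rintro ⟨⟨h1, h2⟩, h3, h4⟩
        rcases le_total x (i + (m + 1)) with h | h
        · exact Or.inl ⟨⟨h1, h⟩, h3, h4⟩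
        · exact Or.inr ⟨⟨h, by linarith⟩, h3, h4⟩
      · have : (0 : ℝ) ≤ m := m.cast_nonneg
        rintro (⟨⟨h1, h2⟩, h3, h4⟩ | ⟨⟨h1, h2⟩, h3, h4⟩) <;>
          refine ⟨⟨?_, ?_⟩, ?_, ?_⟩ <;> linarith
    · rintro x y ⟨⟨h1, h2⟩, h3, h4⟩ ⟨⟨h5, h6⟩, h7, h8⟩
      linarith

lemma dissects_lattice_rect (hi : LinearIndependent ℝ ![u, v])
    (hP : ∀ t : PlaneTriangle, dist (t.points 0) (t.points 1) = ‖u‖ →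
      dist (t.points 0) (t.points 2) = ‖v‖ → dist (t.points 1) (t.points 2) = ‖u - v‖ → P t)
    (i j : ℝ) (m n : ℕ) :
    Dissects P (region O u v fun x y =>
      (i ≤ x ∧ x ≤ i + (m + 1)) ∧ j ≤ y ∧ y ≤ j + (n + 1)) := by
  induction n with
  | zero => simpa using dissects_lattice_row hi hP i j m
  | succ n ih =>
    refine ih.glue hi (dissects_lattice_row hi hP i (j + (n + 1)) m) 0 1 (j + (n + 1))
      (by norm_num) ?_ ?_
    · intro x y
      push_cast
      constructor
      · rintro ⟨⟨h1, h2⟩, h3, h4⟩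
        rcases le_total y (j + (n + 1)) with h | h
        · exact Or.inl ⟨⟨h1, h2⟩, h3, h⟩
        · exact Or.inr ⟨⟨h1, h2⟩, h, by linarith⟩
      · have : (0 : ℝ) ≤ n := n.cast_nonneg
        rintro (⟨⟨h1, h2⟩, h3, h4⟩ | ⟨⟨h1, h2⟩, h3, h4⟩) <;>
          refine ⟨⟨?_, ?_⟩, ?_, ?_⟩ <;> linarith
    · rintro x y ⟨⟨h1, h2⟩, h3, h4⟩ ⟨⟨h5, h6⟩, h7, h8⟩
      linarith

lemma dissects_lattice_triangle (hi : LinearIndependent ℝ ![u, v])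
    (hP : ∀ t : PlaneTriangle, dist (t.points 0) (t.points 1) = ‖u‖ →
      dist (t.points 0) (t.points 2) = ‖v‖ → dist (t.points 1) (t.points 2) = ‖u - v‖ → P t)
    (i : ℝ) (k : ℕ) : ∀ j : ℝ,
    Dissects P (region O u v fun x y => i ≤ x ∧ j ≤ y ∧ x + y ≤ i + j + (k + 1)) := by
  induction k with
  | zero => intro j; simpa using dissects_lattice_up hi hP i j
  | succ k ih =>
    intro j
    have hk : (0 : ℝ) ≤ k := k.cast_nonneg
    -- `k` encodes a triangle of side `k + 1`. The bottom row of the one of side `k + 2` is `k + 1`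
    -- parallelograms followed by one upward triangle.
    have bottom : Dissects P (region O u v fun x y =>
        i ≤ x ∧ (j ≤ y ∧ y ≤ j + 1) ∧ x + y ≤ i + j + (k + 1 + 1)) := by
      refine (dissects_lattice_row hi hP i j k).glue hi
        (dissects_lattice_up hi hP (i + (k + 1)) j) 1 0 (i + (k + 1)) (by norm_num) ?_ ?_
      · intro x y
        constructor
        · rintro ⟨h1, ⟨h2, h3⟩, h4⟩
          rcases le_total x (i + (k + 1)) with h | h
          · exact Or.inl ⟨⟨h1, h⟩, h2, h3⟩
          · exact Or.inr ⟨h, h2, by linarith⟩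
        · rintro (⟨⟨h1, h2⟩, h3, h4⟩ | ⟨h1, h3, h4⟩) <;>
            refine ⟨?_, ⟨?_, ?_⟩, ?_⟩ <;> linarith
      · rintro x y ⟨⟨h1, h2⟩, h3, h4⟩ ⟨h5, h6, h7⟩
        linarith
    refine bottom.glue hi (ih (j + 1)) 0 1 (j + 1) (by norm_num) ?_ ?_
    · intro x y
      push_cast
      constructor
      · rintro ⟨h1, h2, h3⟩
        rcases le_total y (j + 1) with h | h
        · exact Or.inl ⟨h1, ⟨h2, h⟩, by linarith⟩
        · exact Or.inr ⟨h1, h, by linarith⟩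
      · rintro (⟨h1, ⟨h2, h3⟩, h4⟩ | ⟨h1, h3, h4⟩) <;>
          refine ⟨?_, ?_, ?_⟩ <;> linarith
    · rintro x y ⟨h1, ⟨h2, h3⟩, h4⟩ ⟨h5, h6, h7⟩
      linarith

end lattice

lemma linearIndependent_smul_smul {u v : Plane} (hi : LinearIndependent ℝ ![u, v]) {a b : ℝ}
    (ha : a ≠ 0) (hb : b ≠ 0) : LinearIndependent ℝ ![a • u, b • v] := by
  rw [LinearIndependent.pair_iff] at hi ⊢
  intro x y h
  rw [smul_smul, smul_smul] at h
  obtain ⟨h1, h2⟩ := hi _ _ h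
  exact ⟨(mul_eq_zero.1 h1).resolve_right ha, (mul_eq_zero.1 h2).resolve_right hb⟩

/-- The rescaled coordinates of a region. -/
lemma region_smul {O u v : Plane} {a b : ℝ} (ha : a ≠ 0) (hb : b ≠ 0) (x₀ y₀ : ℝ)
    (S : ℝ → ℝ → Prop) :
    region (O + x₀ • u + y₀ • v) (a • u) (b • v) S =
      region O u v fun x y => S ((x - x₀) / a) ((y - y₀) / b) := by
  ext z
  constructor
  · rintro ⟨x, y, h, rfl⟩
    refine ⟨x₀ + x * a, y₀ + y * b, ?_, by module⟩
    simpa [ha, hb] using h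
  · rintro ⟨x, y, h, rfl⟩
    refine ⟨_, _, h, ?_⟩
    rw [smul_smul, smul_smul, div_mul_cancel₀ _ ha, div_mul_cancel₀ _ hb]
    module

lemma linearIndependent_sides (T : PlaneTriangle) :
    LinearIndependent ℝ ![T.points 1 - T.points 0, T.points 2 - T.points 0] := by
  have hD : T.det ≠ 0 := by
    intro h
    have := T.volume_closedInterior_ne_zero
    rw [volume_closedInterior, h] at this
    simp at this
  rw [LinearIndependent.pair_iff]
  intro x y h
  have h0 := congrArg (fun w : Plane => w 0) h
  have h1 := congrArg (fun w : Plane => w 1) h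
  simp at h0 h1
  rw [det] at hD
  constructor
  · apply mul_right_cancel₀ hD
    linear_combination (T.points 2 1 - T.points 0 1) * h0 - (T.points 2 0 - T.points 0 0) * h1
  · apply mul_right_cancel₀ hD
    linear_combination -(T.points 1 1 - T.points 0 1) * h0 + (T.points 1 0 - T.points 0 0) * h1

lemma closedInterior_eq_region (T : PlaneTriangle) :
    T.closedInterior = region (T.points 0) (T.points 1 - T.points 0) (T.points 2 - T.points 0)
      fun x y => 0 ≤ x ∧ 0 ≤ y ∧ x + y ≤ 1 := by
  ext z
  simp only [mem_closedInterior_iff_exists, region, Set.mem_ofPred_eq, and_assoc]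

lemma HasSides.exists_reindex {T : PlaneTriangle} {x y z : ℝ} (h : T.HasSides x y z) :
    ∃ S : PlaneTriangle, S.closedInterior = T.closedInterior ∧
      dist (S.points 1) (S.points 2) = x ∧ dist (S.points 2) (S.points 0) = y ∧
      dist (S.points 0) (S.points 1) = z := by
  obtain ⟨σ, h0, h1, h2⟩ := h
  exact ⟨T.reindex σ.symm, by simp, by simpa using h0, by simpa using h1, by simpa using h2⟩

/-! ### Quadratic tilings and common refinements. -/

/-- The quadratic tiling. -/
lemma dissects_hasSides_div {T : PlaneTriangle} {x y z : ℝ} (h : T.HasSides x y z) (k : ℕ) :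
    Dissects (fun t => t.HasSides (x / (k + 1)) (y / (k + 1)) (z / (k + 1))) T.closedInterior := by
  obtain ⟨S, hS, h0, h1, h2⟩ := h.exists_reindex
  have hk : (0 : ℝ) < k + 1 := by positivity
  set c : ℝ := ((k : ℝ) + 1)⁻¹ with hc
  have hc0 : 0 < c := inv_pos.2 hk
  have hi := linearIndependent_smul_smul S.linearIndependent_sides hc0.ne' hc0.ne'
  have key := dissects_lattice_triangle (O := S.points 0)
    (P := fun t => t.HasSides (x / (k + 1)) (y / (k + 1)) (z / (k + 1))) hi ?_ 0 k 0
  · have hreg := region_smul (O := S.points 0) (u := S.points 1 - S.points 0)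
      (v := S.points 2 - S.points 0) hc0.ne' hc0.ne' 0 0
      (fun x y => 0 ≤ x ∧ 0 ≤ y ∧ x + y ≤ 0 + 0 + ((k : ℝ) + 1))
    rw [zero_smul, zero_smul, add_zero, add_zero] at hreg
    rw [hreg] at key
    rw [← hS, closedInterior_eq_region]
    convert! key using 4 with a b
    rw [sub_zero, sub_zero, hc, div_inv_eq_mul, div_inv_eq_mul, ← add_mul, zero_add, zero_add,
      mul_nonneg_iff_of_pos_right hk, mul_nonneg_iff_of_pos_right hk, mul_le_iff_le_one_left hk]
  · intro t e1 e2 e3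
    rw [norm_smul, Real.norm_of_nonneg hc0.le, ← dist_eq_norm,
      dist_comm (S.points 1), h2] at e1
    rw [norm_smul, Real.norm_of_nonneg hc0.le, ← dist_eq_norm, h1] at e2
    rw [← smul_sub, sub_sub_sub_cancel_right, norm_smul, Real.norm_of_nonneg hc0.le,
      ← dist_eq_norm, h0] at e3
    refine ⟨Equiv.refl _, ?_, ?_, ?_⟩
    · simp only [Equiv.refl_apply]; rw [e3, hc, inv_mul_eq_div]
    · simp only [Equiv.refl_apply]; rw [dist_comm, e2, hc, inv_mul_eq_div]
    · simp only [Equiv.refl_apply]; rw [e1, hc, inv_mul_eq_div]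

/-- `t` is similar to the triangle with sides `l * s`, `l * b`, `l`, with rational ratio. -/
def IsRationallySimilar (s b : ℚ) (l : ℝ) (t : PlaneTriangle) : Prop :=
  ∃ k : ℚ, 0 < k ∧ t.HasSides (k * (l * s)) (k * (l * b)) (k * l)

/-- Triangles rationally similar to a tile have a common refinement. -/
lemma Dissects.exists_common_tile {s b : ℚ} {l : ℝ} {S : Set Plane}
    (h : Dissects (IsRationallySimilar s b l) S) :
    ∃ K : ℕ, Dissects
      (fun t => t.HasSides (l * s / (K + 1)) (l * b / (K + 1)) (l / (K + 1))) S := by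
  induction h with
  | triangle t ht =>
    obtain ⟨k, hk, ht⟩ := ht
    obtain ⟨m, hm⟩ : ∃ m : ℕ, k.num = m + 1 :=
      ⟨(k.num - 1).toNat, by have := Rat.num_pos.2 hk; omega⟩
    obtain ⟨n, hn⟩ : ∃ n : ℕ, k.den = n + 1 := ⟨k.den - 1, by have := k.den_pos; omega⟩
    have hkq : (k : ℝ) = (m + 1) / (n + 1) := by
      rw [Rat.cast_def, hm, hn]; push_cast; rfl
    -- For ratio `(m + 1)/(n + 1)`, dividing the sides by `m + 1` leaves tiles of scale `1/(n + 1)`.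
    refine ⟨n, (dissects_hasSides_div ht m).bind fun t' ht' => .triangle t' ?_⟩
    rw [hkq] at ht'
    convert ht' using 1 <;> field_simp
  | union _ _ hd h1 h2 =>
    obtain ⟨m, h1⟩ := h1
    obtain ⟨n, h2⟩ := h2
    -- `K` encodes the denominator `K + 1`; the two denominators are multiplied.
    refine ⟨(m + 1) * (n + 1) - 1, ?_⟩
    have hK : ((((m + 1) * (n + 1) - 1 : ℕ) : ℝ) + 1) = (m + 1) * (n + 1) := by
      rw [Nat.cast_sub (by nlinarith)]; push_cast; ring
    rw [hK]
    refine .union (h1.bind fun t ht => ?_) (h2.bind fun t ht => ?_) hd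
    · have := dissects_hasSides_div ht n
      simpa only [div_div] using this
    · have := dissects_hasSides_div ht m
      simpa only [div_div, mul_comm] using this

/-! ### The explicit dissection in an oblique frame. -/

/-- The frame vectors have length `l` and enclose the smallest angle of the tile. -/
structure TileFrame (s b : ℚ) (l : ℝ) (u v : Plane) : Prop where
  s_pos : 0 < s
  b_pos : 0 < b
  b_lt : b < 1
  sq_s : s ^ 2 = 1 - b
  l_pos : 0 < l
  norm_u : ‖u‖ = l
  norm_v : ‖v‖ = l
  inner_uv : inner ℝ u v = l ^ 2 * (1 + b) / 2

namespace TileFrame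

variable {s b : ℚ} {l : ℝ} {u v : Plane}

lemma linearIndependent (h : TileFrame s b l u v) : LinearIndependent ℝ ![u, v] := by
  rw [LinearIndependent.pair_iff]
  intro x y hxy
  have hb0 : (0 : ℝ) < b := by exact_mod_cast h.b_pos
  have hb1 : (b : ℝ) < 1 := by exact_mod_cast h.b_lt
  have h1 : ‖x • u + y • v‖ ^ 2 = l ^ 2 * (x ^ 2 + y ^ 2 + (1 + b) * (x * y)) := by
    rw [norm_add_sq_real, inner_smul_left, inner_smul_right, norm_smul, norm_smul, mul_pow,
      mul_pow, Real.norm_eq_abs, Real.norm_eq_abs, sq_abs, sq_abs, h.norm_u, h.norm_v, h.inner_uv]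
    simp only [conj_trivial]
    ring
  rw [hxy, norm_zero, zero_pow two_ne_zero] at h1
  have hl : l ^ 2 ≠ 0 := pow_ne_zero 2 h.l_pos.ne'
  have h2 := (mul_eq_zero.1 h1.symm).resolve_left hl
  -- The quadratic form is positive definite: twice it equals `(1 - b)(x² + y²) + (1 + b)(x + y)²`.
  have h3 : (1 - b) * (x ^ 2 + y ^ 2) ≤ 0 := by
    nlinarith [mul_nonneg (by linarith : (0 : ℝ) ≤ 1 + b) (sq_nonneg (x + y))]
  have h4 : x ^ 2 + y ^ 2 ≤ 0 := nonpos_of_mul_nonpos_right h3 (by linarith)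
  constructor
  · exact pow_eq_zero_iff two_ne_zero |>.1 (by nlinarith [sq_nonneg x, sq_nonneg y])
  · exact pow_eq_zero_iff two_ne_zero |>.1 (by nlinarith [sq_nonneg x, sq_nonneg y])

lemma dist_eq (h : TileFrame s b l u v) (O : Plane) {x y x' y' L : ℝ} (hL : 0 ≤ L)
    (hd : (x - x') ^ 2 + (1 + b) * ((x - x') * (y - y')) + (y - y') ^ 2 = L ^ 2) :
    dist (O + x • u + y • v) (O + x' • u + y' • v) = L * l := by
  refine dist_frame O u v (mul_nonneg hL h.l_pos.le) ?_
  rw [h.norm_u, h.norm_v, h.inner_uv, mul_pow, ← hd]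
  ring

/-- A triangle similar to the tile, with vertices of angles `α`, `β`, `γ`. -/
lemma dissects_triangle (h : TileFrame s b l u v) {O : Plane} {S : ℝ → ℝ → Prop}
    {x₀ y₀ x₁ y₁ x₂ y₂ : ℝ} (k : ℚ) (hk : 0 < k)
    (hd₀ : (x₁ - x₂) ^ 2 + (1 + b) * ((x₁ - x₂) * (y₁ - y₂)) + (y₁ - y₂) ^ 2 =
      (k : ℝ) ^ 2 * (1 - b))
    (hd₁ : (x₂ - x₀) ^ 2 + (1 + b) * ((x₂ - x₀) * (y₂ - y₀)) + (y₂ - y₀) ^ 2 =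
      ((k : ℝ) * b) ^ 2)
    (hd₂ : (x₀ - x₁) ^ 2 + (1 + b) * ((x₀ - x₁) * (y₀ - y₁)) + (y₀ - y₁) ^ 2 =
      (k : ℝ) ^ 2)
    (c₀ d₀ e₀ c₁ d₁ e₁ c₂ d₂ e₂ : ℝ)
    (hS : ∀ x y, S x y ↔ 0 ≤ c₀ * x + d₀ * y + e₀ ∧ 0 ≤ c₁ * x + d₁ * y + e₁ ∧
      0 ≤ c₂ * x + d₂ * y + e₂)
    (h00 : 0 < c₀ * x₀ + d₀ * y₀ + e₀) (h01 : c₀ * x₁ + d₀ * y₁ + e₀ = 0)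
    (h02 : c₀ * x₂ + d₀ * y₂ + e₀ = 0)
    (h10 : c₁ * x₀ + d₁ * y₀ + e₁ = 0) (h11 : 0 < c₁ * x₁ + d₁ * y₁ + e₁)
    (h12 : c₁ * x₂ + d₁ * y₂ + e₁ = 0)
    (h20 : c₂ * x₀ + d₂ * y₀ + e₂ = 0) (h21 : c₂ * x₁ + d₂ * y₁ + e₂ = 0)
    (h22 : 0 < c₂ * x₂ + d₂ * y₂ + e₂) :
    Dissects (IsRationallySimilar s b l) (region O u v S) := by
  refine dissects_region_triangle h.linearIndependent c₀ d₀ e₀ c₁ d₁ e₁ c₂ d₂ e₂ hS h00 h01 h02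
    h10 h11 h12 h20 h21 h22 fun t t0 t1 t2 => ⟨k, hk, Equiv.refl _, ?_, ?_, ?_⟩
  · have hkR : (0 : ℝ) < k := by exact_mod_cast hk
    have hsR : (0 : ℝ) < s := by exact_mod_cast h.s_pos
    have hsb : (s : ℝ) ^ 2 = 1 - b := by exact_mod_cast h.sq_s
    simp only [Equiv.refl_apply, t1, t2]
    rw [h.dist_eq O (L := k * s) (by positivity) (by rw [hd₀, mul_pow, hsb])]
    ring
  · have hkR : (0 : ℝ) < k := by exact_mod_cast hk
    have hbR : (0 : ℝ) < b := by exact_mod_cast h.b_pos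
    simp only [Equiv.refl_apply, t2, t0]
    rw [h.dist_eq O (L := k * b) (by positivity) hd₁]
    ring
  · have hkR : (0 : ℝ) < k := by exact_mod_cast hk
    simp only [Equiv.refl_apply, t0, t1]
    exact h.dist_eq O (L := k) hkR.le hd₂

/-- A parallelogram with an angle `α` and rational sides. -/
lemma dissects_parallelogram (h : TileFrame s b l u v) (O : Plane) {p q : ℚ} (hp : 0 < p)
    (hq : 0 < q) : Dissects (IsRationallySimilar s b l)
      (region O u v fun x y => (0 ≤ x ∧ x ≤ p) ∧ 0 ≤ y ∧ y ≤ q) := by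
  have hbR : (0 : ℝ) < b := by exact_mod_cast h.b_pos
  -- The sides of the tile at `α` are proportional to `b` and `1`. The scale `k` is chosen so that
  -- `kb` divides `p` and `k` divides `q` a whole number of times.
  obtain ⟨k, hk, m, n, hm, hn⟩ : ∃ k : ℚ, 0 < k ∧ ∃ m n : ℕ, p = (m + 1) * (k * b) ∧
      q = (n + 1) * k := by
    have hr : 0 < p / b := div_pos hp h.b_pos
    have h1 := Rat.num_pos.2 hr
    have h2 := Rat.num_pos.2 hq
    have d1 : (0 : ℚ) < (p / b).den := by exact_mod_cast (p / b).den_pos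
    have d2 : (0 : ℚ) < q.den := by exact_mod_cast q.den_pos
    have e1 : p / b = (p / b).num / (p / b).den := (Rat.num_div_den _).symm
    have e2 : q = q.num / q.den := (Rat.num_div_den _).symm
    obtain ⟨m, hm⟩ : ∃ m : ℕ, (p / b).num * q.den = m + 1 :=
      ⟨((p / b).num * q.den - 1).toNat, by
        have : 0 < (p / b).num * q.den := mul_pos h1 (by exact_mod_cast q.den_pos)
        omega⟩
    obtain ⟨n, hn⟩ : ∃ n : ℕ, q.num * (p / b).den = n + 1 :=
      ⟨(q.num * (p / b).den - 1).toNat, by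
        have : 0 < q.num * (p / b).den := mul_pos h2 (by exact_mod_cast (p / b).den_pos)
        omega⟩
    have hm' : ((p / b).num : ℚ) * q.den = m + 1 := by exact_mod_cast hm
    have hn' : (q.num : ℚ) * (p / b).den = n + 1 := by exact_mod_cast hn
    refine ⟨1 / ((p / b).den * q.den), by positivity, m, n, ?_, ?_⟩
    · rw [← hm']
      have : p = p / b * b := (div_mul_cancel₀ _ h.b_pos.ne').symm
      conv_lhs => rw [this, e1]
      field_simp
    · rw [← hn']
      conv_lhs => rw [e2]
      field_simp
  have hkR : (0 : ℝ) < k := by exact_mod_cast hk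
  have hsR : (0 : ℝ) < s := by exact_mod_cast h.s_pos
  have hsb : (s : ℝ) ^ 2 = 1 - b := by exact_mod_cast h.sq_s
  have ha0 : (k * b : ℝ) ≠ 0 := by positivity
  have key := dissects_lattice_rect (O := O) (P := IsRationallySimilar s b l)
    (linearIndependent_smul_smul h.linearIndependent ha0 hkR.ne') ?_ 0 0 m n
  · have hreg := region_smul (O := O) (u := u) (v := v) ha0 hkR.ne' 0 0
      (fun x y => (0 ≤ x ∧ x ≤ 0 + ((m : ℝ) + 1)) ∧ 0 ≤ y ∧ y ≤ 0 + ((n : ℝ) + 1))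
    rw [zero_smul, zero_smul, add_zero, add_zero] at hreg
    rw [hreg] at key
    convert! key using 4 with x y
    rw [sub_zero, sub_zero, zero_add, zero_add, div_le_iff₀ (by positivity), div_le_iff₀ hkR,
      le_div_iff₀ (by positivity : (0 : ℝ) < k * b), le_div_iff₀ hkR, zero_mul, zero_mul, hm, hn]
    push_cast
    rfl
  · intro t e1 e2 e3
    rw [norm_smul, Real.norm_of_nonneg (by positivity), h.norm_u] at e1
    rw [norm_smul, Real.norm_of_nonneg (by positivity), h.norm_v] at e2
    have hn : ‖(k * b : ℝ) • u - (k : ℝ) • v‖ = k * s * l := by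
      have := h.dist_eq 0 (x := k * b) (y := 0) (x' := 0) (y' := k) (L := k * s) (by positivity)
        (by rw [mul_pow, hsb]; ring)
      rw [← this, dist_eq_norm]
      congr 1
      module
    rw [hn] at e3
    refine ⟨k, hk, Equiv.swap 1 2, ?_, ?_, ?_⟩
    · rw [Equiv.swap_apply_left, Equiv.swap_apply_right, dist_comm, e3]; ring
    · rw [Equiv.swap_apply_right, Equiv.swap_apply_of_ne_of_ne (by decide) (by decide), dist_comm,
        e1]; ring
    · rw [Equiv.swap_apply_left, Equiv.swap_apply_of_ne_of_ne (by decide) (by decide), e2]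

/-- An isosceles trapezoid made of three triangles similar to the tile. -/
lemma dissects_isosceles_trapezoid (h : TileFrame s b l u v) (O : Plane) {η : ℚ} (hη : 0 < η) :
    Dissects (IsRationallySimilar s b l) (region O u v fun x y =>
      (0 ≤ x ∧ x ≤ b * η) ∧ 0 ≤ y ∧ (1 + b) * x + y ≤ (1 + b ^ 2) * η) := by
  have hi := h.linearIndependent
  have hb0 : (0 : ℝ) < b := by exact_mod_cast h.b_pos
  have hb1 : (b : ℝ) < 1 := by exact_mod_cast h.b_lt
  have hs0 : (0 : ℝ) < s := by exact_mod_cast h.s_pos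
  have hsb : (s : ℝ) ^ 2 = 1 - b := by exact_mod_cast h.sq_s
  have hη0 : (0 : ℝ) < η := by exact_mod_cast hη
  have hbη : (0 : ℝ) < b * η := by positivity
  have hbη' : (0 : ℝ) < (1 - b) * η := mul_pos (by linarith) hη0
  have left : Dissects (IsRationallySimilar s b l) (region O u v fun x y =>
      0 ≤ x ∧ 0 ≤ y ∧ x + b * y ≤ b * η) := by
    refine h.dissects_triangle (x₀ := 0) (y₀ := 0) (x₁ := 0) (y₁ := η) (x₂ := b * η) (y₂ := 0)
      η hη (by ring) (by ring) (by ring) (-1) (-b) (b * η) 0 1 0 1 0 0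
      (fun x y => ⟨fun ⟨h1, h2, h3⟩ => ⟨by linarith, by linarith, by linarith⟩,
        fun ⟨h1, h2, h3⟩ => ⟨by linarith, by linarith, by linarith⟩⟩)
      (by linarith) (by ring) (by ring) (by ring) (by linarith) (by ring) (by ring) (by ring)
      (by linarith)
  -- The ratio is `sη`: here the rationality of `s` itself enters, not just that of `b`.
  have middle : Dissects (IsRationallySimilar s b l) (region O u v fun x y =>
      x ≤ b * η ∧ b * η ≤ x + b * y ∧ x + y ≤ η) := by
    refine h.dissects_triangle (x₀ := 0) (y₀ := η) (x₁ := b * η) (y₁ := 0) (x₂ := b * η)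
      (y₂ := (1 - b) * η) (s * η) (mul_pos h.s_pos hη) ?_ ?_ ?_ (-1) 0 (b * η) (-1) (-1) η 1 b
      (-(b * η))
      (fun x y => ⟨fun ⟨h1, h2, h3⟩ => ⟨by linarith, by linarith, by linarith⟩,
        fun ⟨h1, h2, h3⟩ => ⟨by linarith, by linarith, by linarith⟩⟩)
      (by linarith) (by ring) (by ring) (by ring) (by linarith) (by ring) (by ring) (by ring)
      (by linarith [mul_pos hb0 hbη'])
    · push_cast; rw [mul_pow, hsb]; ring
    · push_cast; rw [mul_pow, mul_pow, hsb]; ring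
    · push_cast; rw [mul_pow, hsb]; ring
  have right : Dissects (IsRationallySimilar s b l) (region O u v fun x y =>
      0 ≤ x ∧ η ≤ x + y ∧ (1 + b) * x + y ≤ (1 + b ^ 2) * η) := by
    refine h.dissects_triangle (x₀ := 0) (y₀ := (1 + b ^ 2) * η) (x₁ := b * η)
      (y₁ := (1 - b) * η) (x₂ := 0) (y₂ := η) (b * η) (mul_pos h.b_pos hη) ?_ ?_ ?_
      1 1 (-η) 1 0 0 (-(1 + b)) (-1) ((1 + b ^ 2) * η)
      (fun x y => ⟨fun ⟨h1, h2, h3⟩ => ⟨by linarith, by linarith, by linarith⟩,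
        fun ⟨h1, h2, h3⟩ => ⟨by linarith, by linarith, by linarith⟩⟩)
      (by linarith [mul_pos hb0 hbη]) (by ring) (by ring) (by ring) (by linarith) (by ring)
      (by ring) (by ring) (by linarith [mul_pos hb0 hbη])
    · push_cast; ring
    · push_cast; ring
    · push_cast; ring
  have lower : Dissects (IsRationallySimilar s b l) (region O u v fun x y =>
      (0 ≤ x ∧ x ≤ b * η) ∧ 0 ≤ y ∧ x + y ≤ η) := by
    refine left.glue hi middle 1 b (b * η) (by norm_num) ?_ ?_
    · intro x y
      constructor
      · rintro ⟨⟨h1, h2⟩, h3, h4⟩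
        rcases le_total (x + b * y) (b * η) with h | h
        · exact Or.inl ⟨h1, h3, h⟩
        · exact Or.inr ⟨h2, h, h4⟩
      · rintro (⟨h1, h2, h3⟩ | ⟨h1, h2, h3⟩)
        · refine ⟨⟨h1, by linarith [mul_nonneg hb0.le h2]⟩, h2, ?_⟩
          refine le_of_mul_le_mul_left ?_ hb0
          nlinarith
        · refine ⟨⟨?_, h1⟩, ?_, h3⟩
          · have : 0 ≤ (1 - b) * x := by nlinarith
            exact nonneg_of_mul_nonneg_right this (by linarith)
          · exact nonneg_of_mul_nonneg_right (by linarith : 0 ≤ b * y) hb0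
    · rintro x y ⟨h1, h2, h3⟩ ⟨h4, h5, h6⟩
      linarith
  refine lower.glue hi right 1 1 η (by norm_num) ?_ ?_
  · intro x y
    constructor
    · rintro ⟨⟨h1, h2⟩, h3, h4⟩
      rcases le_total (x + y) η with h | h
      · exact Or.inl ⟨⟨h1, h2⟩, h3, h⟩
      · exact Or.inr ⟨h1, h, h4⟩
    · rintro (⟨⟨h1, h2⟩, h3, h4⟩ | ⟨h1, h2, h3⟩)
      · refine ⟨⟨h1, h2⟩, h3, ?_⟩
        nlinarith
      · have hx : x ≤ b * η := by
          refine le_of_mul_le_mul_left ?_ hb0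
          nlinarith
        exact ⟨⟨h1, hx⟩, by nlinarith, h3⟩
  · rintro x y ⟨⟨h1, h2⟩, h3, h4⟩ ⟨h5, h6, h7⟩
    linarith

/-- A translated isosceles trapezoid on top of a parallelogram. -/
lemma dissects_strip (h : TileFrame s b l u v) (O : Plane) {η w : ℚ} (hη : 0 < η)
    (hw : 0 < w) (x₀ : ℝ) :
    Dissects (IsRationallySimilar s b l) (region O u v fun x y =>
      (x₀ ≤ x ∧ x ≤ x₀ + b * η) ∧ 0 ≤ y ∧
        (1 + b) * (x - x₀) + y ≤ w + (1 + b ^ 2) * η) := by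
  have hi := h.linearIndependent
  have hb0 : (0 : ℝ) < b := by exact_mod_cast h.b_pos
  have hb1 : (b : ℝ) < 1 := by exact_mod_cast h.b_lt
  have hη0 : (0 : ℝ) < η := by exact_mod_cast hη
  have lower := h.dissects_parallelogram (O + x₀ • u + (0 : ℝ) • v) (mul_pos h.b_pos hη) hw
  have upper := h.dissects_isosceles_trapezoid (O + x₀ • u + (w : ℝ) • v) hη
  have e₁ := fun y₀ => region_smul (O := O) (u := u) (v := v) one_ne_zero one_ne_zero x₀ y₀
  simp only [one_smul, div_one] at e₁
  rw [e₁] at lower upper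
  refine lower.glue hi upper 0 1 w (by norm_num) ?_ ?_
  · intro x y
    push_cast
    constructor
    · rintro ⟨⟨h1, h2⟩, h3, h4⟩
      rcases le_total y w with h | h
      · exact Or.inl ⟨⟨by linarith, by linarith⟩, by linarith, by linarith⟩
      · exact Or.inr ⟨⟨by linarith, by linarith⟩, by linarith, by linarith⟩
    · rintro (⟨⟨h1, h2⟩, h3, h4⟩ | ⟨⟨h1, h2⟩, h3, h4⟩)
      · refine ⟨⟨by linarith, by linarith⟩, by linarith, ?_⟩
        nlinarith
      · have : (0 : ℝ) < w := by exact_mod_cast hw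
        exact ⟨⟨by linarith, by linarith⟩, by linarith, by linarith⟩
  · rintro x y ⟨⟨h1, h2⟩, h3, h4⟩ ⟨⟨h5, h6⟩, h7, h8⟩
    linarith

/-- All caps have the same size, and the parallelogram below the cap shrinks as `k` grows. For the
last strip `k = n` its height is `b² - (1 - b)η`, so `hsmall` is exactly the condition that every
strip fits. -/
lemma dissects_stack (h : TileFrame s b l u v) (O : Plane) {η : ℚ} (hη : 0 < η) {n : ℕ}
    (hn : (n + 1) * (b * η) = 1 - b) (hsmall : (1 - b) * η < b ^ 2) (k : ℕ) (hk : k ≤ n) :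
    Dissects (IsRationallySimilar s b l) (region O u v fun x y =>
      (0 ≤ x ∧ x ≤ (k + 1) * (b * η)) ∧ 0 ≤ y ∧ (1 + b) * x + y ≤ 1) := by
  have hi := h.linearIndependent
  have hbη : 0 < b * η := mul_pos h.b_pos hη
  have strip : ∀ k : ℕ, k ≤ n → Dissects (IsRationallySimilar s b l) (region O u v fun x y =>
      ((k : ℝ) * (b * η) ≤ x ∧ x ≤ (k + 1) * (b * η)) ∧ 0 ≤ y ∧ (1 + b) * x + y ≤ 1) := by
    intro k hk
    have hw : 0 < 1 - (1 + b) * (k * (b * η)) - (1 + b ^ 2) * η := by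
      have : (k : ℚ) * (b * η) ≤ n * (b * η) := by
        have : (k : ℚ) ≤ n := by exact_mod_cast hk
        gcongr
      have hb := h.b_pos
      nlinarith
    convert! h.dissects_strip O hη hw ((k : ℝ) * (b * η)) using 4 with x y
    push_cast
    constructor
    · rintro ⟨⟨h1, h2⟩, h3, h4⟩
      exact ⟨⟨h1, by linarith⟩, h3, by linarith⟩
    · rintro ⟨⟨h1, h2⟩, h3, h4⟩
      exact ⟨⟨h1, by linarith⟩, h3, by linarith⟩
  induction k with
  | zero => simpa using strip 0 (Nat.zero_le n)
  | succ k ih =>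
    have hbη' : (0 : ℝ) < b * η := by exact_mod_cast hbη
    have hk0 : (0 : ℝ) ≤ (k + 1) * (b * η) := by positivity
    have := strip (k + 1) hk
    push_cast at this ⊢
    refine (ih (by omega)).glue hi this 1 0 ((k + 1) * (b * η)) (by norm_num) ?_ ?_
    · intro x y
      constructor
      · rintro ⟨⟨h1, h2⟩, h3, h4⟩
        rcases le_total x ((k + 1) * (b * η)) with h | h
        · exact Or.inl ⟨⟨h1, h⟩, h3, h4⟩
        · exact Or.inr ⟨⟨h, h2⟩, h3, h4⟩
      · rintro (⟨⟨h1, h2⟩, h3, h4⟩ | ⟨⟨h1, h2⟩, h3, h4⟩)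
        · exact ⟨⟨h1, by linarith⟩, h3, h4⟩
        · exact ⟨⟨by linarith, h2⟩, h3, h4⟩
    · rintro x y ⟨⟨h1, h2⟩, h3, h4⟩ ⟨⟨h5, h6⟩, h7, h8⟩
      linarith

/-- The isosceles trapezoid with base angles `α` inside the isosceles triangle of apex `α`. -/
lemma dissects_trapezoid (h : TileFrame s b l u v) (O : Plane) :
    Dissects (IsRationallySimilar s b l) (region O u v fun x y =>
      (0 ≤ x ∧ x ≤ 1 - b) ∧ 0 ≤ y ∧ (1 + b) * x + y ≤ 1) := by
  have hb := h.b_pos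
  have hb1 : 0 < 1 - b := sub_pos.2 h.b_lt
  -- With `η = (1 - b)/(b(n + 1))`, the smallness condition reads `(1 - b)²/b³ < n + 1`.
  obtain ⟨n, hn⟩ := exists_nat_gt ((1 - b) ^ 2 / b ^ 3)
  have hn1 : (0 : ℚ) < n + 1 := by positivity
  have hη : 0 < (1 - b) / (b * (n + 1)) := by positivity
  have h1 : ((n : ℚ) + 1) * (b * ((1 - b) / (b * (n + 1)))) = 1 - b := by field_simp
  have h2 : (1 - b) * ((1 - b) / (b * (n + 1))) < b ^ 2 := by
    rw [div_lt_iff₀ (by positivity)] at hn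
    rw [mul_div_assoc', div_lt_iff₀ (by positivity)]
    nlinarith [pow_pos hb 3]
  have := h.dissects_stack O hη h1 h2 n le_rfl
  have h1' : ((n : ℝ) + 1) * (b * ((1 - b) / (b * (n + 1)) : ℚ)) = 1 - b := by
    exact_mod_cast h1
  rwa [h1'] at this

/-- The isosceles triangle with apex angle `α`. -/
lemma dissects_isosceles (h : TileFrame s b l u v) (O : Plane) :
    Dissects (IsRationallySimilar s b l) (region O u v fun x y =>
      0 ≤ x ∧ 0 ≤ y ∧ x + y ≤ 1) := by
  have hi := h.linearIndependent
  have hb0 : (0 : ℝ) < b := by exact_mod_cast h.b_pos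
  have hb1 : (0 : ℝ) < 1 - b := by
    have : (b : ℝ) < 1 := by exact_mod_cast h.b_lt
    linarith
  have hsb : (s : ℝ) ^ 2 = 1 - b := by exact_mod_cast h.sq_s
  have lower : Dissects (IsRationallySimilar s b l) (region O u v fun x y =>
      1 - b ≤ x ∧ 0 ≤ y ∧ b * x + y ≤ b) := by
    refine h.dissects_triangle (x₀ := 1 - b) (y₀ := 0) (x₁ := 1) (y₁ := 0) (x₂ := 1 - b)
      (y₂ := b ^ 2) b h.b_pos (by ring) (by ring) (by ring) (-b) (-1) b 1 0 (-(1 - b)) 0 1 0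
      (fun x y => ⟨fun ⟨h1, h2, h3⟩ => ⟨by linarith, by linarith, by linarith⟩,
        fun ⟨h1, h2, h3⟩ => ⟨by linarith, by linarith, by linarith⟩⟩)
      (by nlinarith) (by ring) (by ring) (by ring) (by linarith) (by ring) (by ring) (by ring)
      (by nlinarith)
  have upper : Dissects (IsRationallySimilar s b l) (region O u v fun x y =>
      x + y ≤ 1 ∧ 1 ≤ (1 + b) * x + y ∧ b ≤ b * x + y) := by
    refine h.dissects_triangle (x₀ := 1) (y₀ := 0) (x₁ := 0) (y₁ := 1) (x₂ := 1 - b)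
      (y₂ := b ^ 2) s h.s_pos (by rw [hsb]; ring) (by rw [mul_pow, hsb]; ring) (by rw [hsb]; ring)
      (1 + b) 1 (-1) b 1 (-b) (-1) (-1) 1
      (fun x y => ⟨fun ⟨h1, h2, h3⟩ => ⟨by linarith, by linarith, by linarith⟩,
        fun ⟨h1, h2, h3⟩ => ⟨by linarith, by linarith, by linarith⟩⟩)
      (by linarith) (by ring) (by ring) (by ring) (by linarith) (by ring) (by ring) (by ring)
      (by nlinarith)
  have both := lower.glue (S := fun x y => (1 - b ≤ x ∧ 0 ≤ y ∧ b * x + y ≤ b) ∨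
    (x + y ≤ 1 ∧ 1 ≤ (1 + b) * x + y ∧ b ≤ b * x + y)) hi upper b 1 b (by norm_num)
    (fun x y => Iff.rfl) (by rintro x y ⟨h1, h2, h3⟩ ⟨h4, h5, h6⟩; linarith)
  -- The trapezoid meets the two triangles along a path broken at `(1 - b, b²)`, hence two
  -- separating lines.
  refine both.glue₂ hi (h.dissects_trapezoid O) 1 0 (1 - b) (1 + b) 1 1 (by norm_num)
    (by norm_num) ?_ ?_
  · intro x y
    constructor
    · rintro ⟨h1, h2, h3⟩
      rcases le_total (b * x + y) b with h | h
      · rcases le_total (1 - b : ℝ) x with hx | hx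
        · exact Or.inl (Or.inl ⟨hx, h2, h⟩)
        · exact Or.inr ⟨⟨h1, hx⟩, h2, by linarith⟩
      · rcases le_total 1 ((1 + b) * x + y) with hx | hx
        · exact Or.inl (Or.inr ⟨h3, hx, h⟩)
        · exact Or.inr ⟨⟨h1, by linarith⟩, h2, hx⟩
    · rintro ((⟨h1, h2, h3⟩ | ⟨h1, h2, h3⟩) | ⟨⟨h1, h2⟩, h3, h4⟩)
      · refine ⟨by linarith, h2, ?_⟩
        have hx : x ≤ 1 := by
          refine le_of_mul_le_mul_left ?_ hb0
          linarith
        nlinarith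
      · refine ⟨nonneg_of_mul_nonneg_right (by linarith : (0 : ℝ) ≤ b * x) hb0,
          nonneg_of_mul_nonneg_right (by nlinarith : (0 : ℝ) ≤ (1 - b) * y) hb1, h1⟩
      · exact ⟨h1, h3, by nlinarith⟩
  · rintro x y (⟨h1, h2, h3⟩ | ⟨h1, h2, h3⟩) ⟨⟨h4, h5⟩, h6, h7⟩
    · left; linarith
    · right; linarith

/-- The triangle with angles `α`, `2α`, `2β`. -/
lemma dissects_main (h : TileFrame s b l u v) (O : Plane) :
    Dissects (IsRationallySimilar s b l) (region O u v fun x y =>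
      0 ≤ y ∧ 0 ≤ (1 + b) * x + y ∧ x + (1 + b) * y ≤ 2 + b) := by
  have hi := h.linearIndependent
  have hb0 : (0 : ℝ) < b := by exact_mod_cast h.b_pos
  have hb1 : (0 : ℝ) < 1 - b := by
    have : (b : ℝ) < 1 := by exact_mod_cast h.b_lt
    linarith
  have hb := h.b_pos
  have hC : (b : ℝ) * (b : ℝ)⁻¹ = 1 := mul_inv_cancel₀ hb0.ne'
  have hinv : (0 : ℝ) < (b : ℝ)⁻¹ := inv_pos.2 hb0
  -- `right` and `left` share the vertex `(-1/b, 1 + 1/b)`, where their angles `β` add up to `2β`.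
  -- Their angles `γ = π/2 + α/2` supplement the base angles of the isosceles triangle.
  have right : Dissects (IsRationallySimilar s b l) (region O u v fun x y =>
      0 ≤ y ∧ 1 ≤ x + y ∧ x + (1 + b) * y ≤ 2 + b) := by
    refine h.dissects_triangle (x₀ := 2 + b) (y₀ := 0) (x₁ := -(b : ℝ)⁻¹) (y₁ := 1 + (b : ℝ)⁻¹)
      (x₂ := 1) (y₂ := 0) (1 + b⁻¹) (by positivity) ?_ ?_ ?_
      1 1 (-1) 0 1 0 (-1) (-(1 + b)) (2 + b)
      (fun x y => ⟨fun ⟨h1, h2, h3⟩ => ⟨by linarith, by linarith, by linarith⟩,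
        fun ⟨h1, h2, h3⟩ => ⟨by linarith, by linarith, by linarith⟩⟩)
      (by linarith) (by ring) (by ring) (by ring) (by linarith) (by ring) (by ring)
      (by linear_combination -hC) (by linarith)
    · push_cast; field_simp; ring
    · push_cast; field_simp; ring
    · push_cast; field_simp; ring
  have left : Dissects (IsRationallySimilar s b l) (region O u v fun x y =>
      x ≤ 0 ∧ 0 ≤ (1 + b) * x + y ∧ x + y ≤ 1) := by
    refine h.dissects_triangle (x₀ := 0) (y₀ := 0) (x₁ := -(b : ℝ)⁻¹) (y₁ := 1 + (b : ℝ)⁻¹)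
      (x₂ := 0) (y₂ := 1) b⁻¹ (by positivity) ?_ ?_ ?_
      (-1) (-1) 1 (-1) 0 0 (1 + b) 1 0
      (fun x y => ⟨fun ⟨h1, h2, h3⟩ => ⟨by linarith, by linarith, by linarith⟩,
        fun ⟨h1, h2, h3⟩ => ⟨by linarith, by linarith, by linarith⟩⟩)
      (by linarith) (by ring) (by ring) (by ring) (by linarith) (by ring) (by ring)
      (by linear_combination -hC) (by linarith)
    · push_cast; field_simp; ring
    · push_cast; field_simp; ring
    · push_cast; field_simp; ring
  have lower : Dissects (IsRationallySimilar s b l) (region O u v fun x y =>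
      0 ≤ y ∧ 0 ≤ (1 + b) * x + y ∧ x + y ≤ 1) := by
    refine (h.dissects_isosceles O).glue hi left 1 0 0 (by norm_num) ?_ ?_
    · intro x y
      constructor
      · rintro ⟨h1, h2, h3⟩
        rcases le_total 0 x with hx | hx
        · exact Or.inl ⟨hx, h1, h3⟩
        · exact Or.inr ⟨hx, h2, h3⟩
      · rintro (⟨h1, h2, h3⟩ | ⟨h1, h2, h3⟩)
        · exact ⟨h2, by positivity, h3⟩
        · exact ⟨by nlinarith, h2, h3⟩
    · rintro x y ⟨h1, h2, h3⟩ ⟨h4, h5, h6⟩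
      linarith
  refine lower.glue hi right 1 1 1 (by norm_num) ?_ ?_
  · intro x y
    constructor
    · rintro ⟨h1, h2, h3⟩
      rcases le_total (x + y) 1 with hx | hx
      · exact Or.inl ⟨h1, h2, hx⟩
      · exact Or.inr ⟨h1, hx, h3⟩
    · rintro (⟨h1, h2, h3⟩ | ⟨h1, h2, h3⟩)
      · exact ⟨h1, h2, by nlinarith⟩
      · refine ⟨h1, ?_, h3⟩
        linarith [mul_nonneg (by linarith : (0 : ℝ) ≤ 2 + b) (sub_nonneg.2 h2)]
  · rintro x y ⟨h1, h2, h3⟩ ⟨h4, h5, h6⟩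
    linarith

end TileFrame

/-- The triangle with angles `A`, `2A`, `π - 3A` in the frame adapted to its dissection. -/
lemma HasSides.dissects {T : PlaneTriangle} {s : ℚ} {l : ℝ} (hs0 : 0 < s) (hs1 : s < 1)
    (hl : 0 < l) (h : T.HasSides l (l * (2 - s ^ 2)) (l * ((1 - s ^ 2) * (3 - s ^ 2)))) :
    Dissects (IsRationallySimilar s (1 - s ^ 2) (l * (1 - s ^ 2))) T.closedInterior := by
  obtain ⟨S, hS, h0, h1, h2⟩ := h.exists_reindex
  obtain ⟨b, hb⟩ : ∃ b : ℚ, b = 1 - s ^ 2 := ⟨_, rfl⟩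
  have hs2 : s ^ 2 < 1 := by nlinarith
  have hb0 : 0 < b := by rw [hb]; linarith
  have hb0R : (0 : ℝ) < b := by exact_mod_cast hb0
  have hbR : (s : ℝ) ^ 2 = 1 - b := by rw [hb]; push_cast; ring
  rw [hbR] at h1 h2 ⊢
  rw [← hb, sub_sub_cancel]
  rw [show l * (2 - (1 - b)) = l * (1 + b) by ring] at h1
  rw [show l * ((1 - (1 - b)) * (3 - (1 - b))) = l * (b * (2 + b)) by ring] at h2
  set p := S.points 0 - S.points 1 with hp
  set q := S.points 2 - S.points 1 with hq
  have np : ‖p‖ = l * (b * (2 + b)) := by rw [hp, ← dist_eq_norm, h2]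
  have nq : ‖q‖ = l := by rw [hq, ← dist_eq_norm, dist_comm, h0]
  have npq : ‖p - q‖ = l * (1 + b) := by
    rw [hp, hq, sub_sub_sub_cancel_right, ← dist_eq_norm, dist_comm, h1]
  have ipq : inner ℝ p q = ((l * (b * (2 + b))) ^ 2 + l ^ 2 - (l * (1 + b)) ^ 2) / 2 := by
    have := norm_sub_sq_real p q
    rw [np, nq, npq] at this
    linarith
  set u := (2 + b : ℝ)⁻¹ • p with hu
  -- Solved from `p = (2 + b)u` and `q = -(1/b)u + (1 + 1/b)v`, the vertex coordinates in
  -- `dissects_main`.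
  set v := ((1 + b : ℝ)⁻¹ * b) • q + ((1 + b : ℝ)⁻¹ * (2 + b : ℝ)⁻¹) • p with hv
  have hpos1 : (0 : ℝ) < 1 + b := by linarith
  have hpos2 : (0 : ℝ) < 2 + b := by linarith
  have nu : ‖u‖ = l * b := by
    rw [hu, norm_smul, Real.norm_of_nonneg (by positivity), np]
    field_simp
  have iuv : inner ℝ u v = (l * b) ^ 2 * (1 + b) / 2 := by
    rw [hu, hv, inner_add_right, inner_smul_left, inner_smul_left, inner_smul_right,
      inner_smul_right, ipq, real_inner_self_eq_norm_sq, np]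
    simp only [conj_trivial]
    field_simp
    ring
  have nv : ‖v‖ = l * b := by
    refine (pow_left_inj₀ (norm_nonneg _) (by positivity) two_ne_zero).1 ?_
    rw [hv, norm_add_sq_real, norm_smul, norm_smul, inner_smul_left, inner_smul_right,
      real_inner_comm, ipq, Real.norm_of_nonneg (by positivity),
      Real.norm_of_nonneg (by positivity), np, nq]
    simp only [conj_trivial]
    field_simp
    ring
  have hf : TileFrame s b (l * b) u v := {
    s_pos := hs0
    b_pos := hb0
    b_lt := by rw [hb]; linarith [pow_pos hs0 2]
    sq_s := by rw [hb]; ring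
    l_pos := by positivity
    norm_u := nu
    norm_v := nv
    inner_uv := iuv }
  have hC : (b : ℝ) * (b : ℝ)⁻¹ = 1 := mul_inv_cancel₀ hb0R.ne'
  have hinv : (0 : ℝ) < (b : ℝ)⁻¹ := inv_pos.2 hb0R
  have key := hf.dissects_main (S.points 1)
  rwa [region_eq_closedInterior S (x₀ := 2 + b) (y₀ := 0) (x₁ := 0) (y₁ := 0)
    (x₂ := -(b : ℝ)⁻¹) (y₂ := 1 + (b : ℝ)⁻¹) ?_ ?_ ?_ (1 + b) 1 0 (-1) (-(1 + b)) (2 + b) 0 1 0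
    (fun x y => ⟨fun ⟨h1, h2, h3⟩ => ⟨by linarith, by linarith, by linarith⟩,
        fun ⟨h1, h2, h3⟩ => ⟨by linarith, by linarith, by linarith⟩⟩)
    (by nlinarith) (by ring) (by linear_combination -hC) (by ring) (by linarith)
    (by linear_combination -hC) (by ring) (by ring) (by linarith), hS] at key
  · rw [hu, smul_smul, mul_inv_cancel₀ hpos2.ne', hp]
    module
  · module
  · have e1 : (-(b : ℝ)⁻¹) * (2 + b : ℝ)⁻¹ +
        (1 + (b : ℝ)⁻¹) * ((1 + b : ℝ)⁻¹ * (2 + b : ℝ)⁻¹) = 0 := by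
      field_simp
      ring
    have e2 : (1 + (b : ℝ)⁻¹) * ((1 + b : ℝ)⁻¹ * b) = 1 := by
      field_simp
      ring
    have : S.points 1 + (-(b : ℝ)⁻¹) • u + (1 + (b : ℝ)⁻¹) • v = S.points 1 +
        ((-(b : ℝ)⁻¹) * (2 + b : ℝ)⁻¹ +
        (1 + (b : ℝ)⁻¹) * ((1 + b : ℝ)⁻¹ * (2 + b : ℝ)⁻¹)) • p +
        ((1 + (b : ℝ)⁻¹) * ((1 + b : ℝ)⁻¹ * b)) • q := by
      rw [hu, hv]; module
    rw [this, e1, e2, hq]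
    module

/-! ### Realizing the tile, and the theorem. -/

/-- The law of cosines, solved for the angle. -/
lemma angleAt_eq_of_cos {T : PlaneTriangle} {i j k : Fin 3} (hij : i ≠ j) (hjk : j ≠ k)
    (hik : i ≠ k) {θ : ℝ} (h0 : 0 ≤ θ) (hpi : θ ≤ Real.pi)
    (h : dist (T.points j) (T.points k) ^ 2 = dist (T.points j) (T.points i) ^ 2 +
      dist (T.points k) (T.points i) ^ 2 -
        2 * dist (T.points j) (T.points i) * dist (T.points k) (T.points i) * Real.cos θ) :
    T.angleAt i = θ := by
  rw [T.angleAt_eq hij hjk hik]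
  refine Real.injOn_cos ⟨EuclideanGeometry.angle_nonneg _ _ _, EuclideanGeometry.angle_le_pi _ _ _⟩
    ⟨h0, hpi⟩ ?_
  have hc := EuclideanGeometry.law_cos (T.points j) (T.points i) (T.points k)
  have p1 : 0 < dist (T.points j) (T.points i) := dist_pos.2 (T.independent.injective.ne hij.symm)
  have p2 : 0 < dist (T.points k) (T.points i) := dist_pos.2 (T.independent.injective.ne hik.symm)
  apply mul_left_cancel₀ (mul_pos p1 p2).ne'
  linarith

/-- A tile with sides proportional to `s`, `1 - s²`, `1`. -/
lemma exists_tile {A s r : ℝ} (hs : s = 2 * Real.sin (A / 2)) (hs0 : 0 < s) (hs1 : s < 1)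
    (hr : 0 < r) (hA : 0 < A) (hA' : 3 * A < Real.pi) :
    ∃ (R : PlaneTriangle) (γ : ℝ), R.HasAngles A ((Real.pi - 3 * A) / 2) γ ∧
      dist (R.points 1) (R.points 2) = r * s ∧ dist (R.points 2) (R.points 0) = r * (1 - s ^ 2) ∧
      dist (R.points 0) (R.points 1) = r := by
  have hcosA : Real.cos A = 1 - s ^ 2 / 2 := by
    rw [hs, show A = 2 * (A / 2) by ring, Real.cos_two_mul, Real.cos_sq']
    ring_nf
  have hcosβ : Real.cos ((Real.pi - 3 * A) / 2) = (3 * s - s ^ 3) / 2 := by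
    rw [show (Real.pi - 3 * A) / 2 = Real.pi / 2 - 3 * (A / 2) by ring, Real.cos_pi_div_two_sub,
      Real.sin_three_mul, hs]
    ring
  have hsinA : 0 < Real.sin A := Real.sin_pos_of_pos_of_lt_pi hA (by linarith)
  have hs2 : 0 < 1 - s ^ 2 := by nlinarith
  let u : Plane := !₂[1, 0]
  let v : Plane := !₂[Real.cos A, Real.sin A]
  have nu : ‖u‖ ^ 2 = 1 := by
    rw [EuclideanSpace.norm_sq_eq]; simp [u, Fin.sum_univ_two]
  have nv : ‖v‖ ^ 2 = 1 := by
    rw [EuclideanSpace.norm_sq_eq]; simp [v, Fin.sum_univ_two]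
  have iuv : inner ℝ u v = 1 - s ^ 2 / 2 := by
    rw [← hcosA]
    simp [u, v, PiLp.inner_apply, Fin.sum_univ_two]
  have hi : LinearIndependent ℝ ![u, v] := by
    rw [LinearIndependent.pair_iff]
    intro x y h
    have h1 := congrArg (fun w : Plane => w 1) h
    have h0 := congrArg (fun w : Plane => w 0) h
    simp [u, v] at h0 h1
    have hy : y = 0 := h1.resolve_right hsinA.ne'
    exact ⟨by simpa [hy] using h0, hy⟩
  obtain ⟨R, r0, r1, r2⟩ := exists_triangle_of_frame 0 hi (x₀ := 0) (y₀ := 0) (x₁ := r) (y₁ := 0)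
    (x₂ := 0) (y₂ := r * (1 - s ^ 2)) (by simp only [sub_zero, zero_mul]; positivity)
  have d12 : dist (R.points 1) (R.points 2) = r * s := by
    rw [r1, r2]
    refine dist_frame 0 u v (by positivity) ?_
    rw [nu, nv, iuv]; ring
  have d20 : dist (R.points 2) (R.points 0) = r * (1 - s ^ 2) := by
    rw [r2, r0]
    refine dist_frame 0 u v (by positivity) ?_
    rw [nu, nv, iuv]; ring
  have d01 : dist (R.points 0) (R.points 1) = r := by
    rw [r0, r1]
    refine dist_frame 0 u v hr.le ?_
    rw [nu, nv, iuv]; ring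
  refine ⟨R, R.angleAt 2, ⟨Equiv.refl _, ?_, ?_, rfl⟩, d12, d20, d01⟩
  · refine angleAt_eq_of_cos (j := 1) (k := 2) (by decide) (by decide) (by decide) hA.le
      (by linarith) ?_
    simp only [Equiv.refl_apply]
    rw [dist_comm (R.points 1) (R.points 0), d12, d20, d01, hcosA]
    ring
  · refine angleAt_eq_of_cos (j := 2) (k := 0) (by decide) (by decide) (by decide) (by linarith)
      (by linarith) ?_
    simp only [Equiv.refl_apply]
    rw [dist_comm (R.points 2) (R.points 1), d12, d20, d01, hcosβ]
    ring

lemma isCongruentTo_of_hasSides {S R : PlaneTriangle} {x y z : ℝ} (hS : S.HasSides x y z)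
    (h0 : dist (R.points 1) (R.points 2) = x) (h1 : dist (R.points 2) (R.points 0) = y)
    (h2 : dist (R.points 0) (R.points 1) = z) : S.IsCongruentTo R := by
  obtain ⟨σ, e0, e1, e2⟩ := hS
  exact isCongruentTo_of_dist_eq σ (e0.trans h0.symm) (e1.trans h1.symm) (e2.trans h2.symm)

end PlaneTriangle

theorem mainTheorem5 (T : PlaneTriangle) (A : ℝ)
    (hT : T.HasAngles A (2 * A) (Real.pi - 3 * A))
    (hincomm : ¬ T.CommensurableAngles)
    (hsin : ∃ q : ℚ, Real.sin (A / 2) = q) :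
    (∃ (R : PlaneTriangle) (α β γ : ℝ), α = A ∧ 3 * α + 2 * β = Real.pi ∧
      R.HasAngles α β γ ∧ ∃ N : ℕ, T.TilesInto R N) ∧
    (∀ (R : PlaneTriangle) (α β γ : ℝ), α = A → 3 * α + 2 * β = Real.pi →
      R.HasAngles α β γ → ∀ N : ℕ, T.TilesInto R N →
        (∃ M : ℤ, ∀ s : ℝ, s = 2 * Real.sin (A / 2) →
          (N : ℝ) = (M : ℝ) ^ 2 * ((2 - s ^ 2) * (3 - s ^ 2)) / ((1 - s) ^ 2 * (2 + s) ^ 2)) ∧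
        ¬ IsSquare N) := by
  obtain ⟨q, hq⟩ := hsin
  obtain ⟨s, hs⟩ : ∃ s : ℝ, s = 2 * Real.sin (A / 2) := ⟨_, rfl⟩
  have hsq : s = ((2 * q : ℚ) : ℝ) := by rw [hs, hq]; push_cast; rfl
  obtain ⟨hs0, hs1, l, hl, hsides⟩ := PlaneTriangle.hasSides_of_hasAngles_two_mul hT hs
  obtain ⟨hA, -, hA3, -, -⟩ := hT.hasSides
  constructor
  · obtain ⟨σ, rfl⟩ : ∃ σ : ℚ, s = σ := ⟨_, hsq⟩
    obtain ⟨K, hK⟩ := (hsides.dissects (by exact_mod_cast hs0) (by exact_mod_cast hs1)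
      hl).exists_common_tile
    obtain ⟨N, t, hP, hcover, hdisj⟩ := hK.exists_fin
    have hs2 : (0 : ℝ) < 1 - σ ^ 2 := by nlinarith
    obtain ⟨R, γ, hR, h0, h1, h2⟩ := PlaneTriangle.exists_tile hs hs0 hs1
      -- The frame of `HasSides.dissects` has unit length `l(1 - σ²)`, so this is the longest side
      -- of the common tile.
      (r := l * (1 - σ ^ 2) / (K + 1)) (by positivity) hA (by linarith)
    refine ⟨R, A, (Real.pi - 3 * A) / 2, γ, rfl, by ring, hR, N, t, ?_, hcover, hdisj⟩
    intro i
    refine PlaneTriangle.isCongruentTo_of_hasSides (hP i) ?_ ?_ h2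
    · rw [h0]; ring
    · rw [h1]; push_cast; ring
  · rintro R α β γ rfl hβ hR N hN
    obtain ⟨r, hr, hRs⟩ := PlaneTriangle.hasSides_of_hasAngles_tile hR hβ hs
    obtain ⟨⟨M, hM⟩, hsquare⟩ := hN.count hsq hs0 hs1 hl hr hsides hRs
    exact ⟨⟨M, fun s' hs' => by rw [hs', ← hs]; exact hM⟩, hsquare⟩
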